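/- **Setting.** Let $\mathfrak o$ be a complete discrete valuation ring with maximal ideal $\mathfrak p$ and finite residue field, let $\ell\ge 0$, $\mathfrak o_\ell=\mathfrak o/\mathfrak p^\ell$, let $R$ be a finite (not necessarily commutative) $\mathfrak o_\ell$-algebra and $K$ an algebraically closed field of characteristic zero. Let $M_1,\dots,M_n$ be pairwise non-isomorphic finite indecomposable left $R$-modules, $a_1,\dots,a_n\in\mathbb N$, and $M=M_1^{a_1}\oplus\cdots\oplus M_n^{a_n}$. *Functor morphing.* Let $\mathcal C=\langle M_1,\dots,M_n\rangle$ be the full subcategory of $R$-modules isomorphic to some $\bigoplus_i M_i^{b_i}$, and let $\mathcal C_{+1}$ be the category of $\mathfrak o_\ell$-linear functors from $\mathcal C$ to $\mathfrak o_\ell$-modules. For $F,G\in\mathcal C_{+1}$ write $G\prec F$ if $G$ is isomorphic to a subquotient of $F$ and $G\not\cong F$. Let $KF(M)$ be the permutation representation of $\mathrm{Aut}_R(M)$ with basis $F(M)$, and let $\overline{KF(M)}$ be its largest subrepresentation $S$ with $\mathrm{Hom}_{\mathrm{Aut}_R(M)}(KG(M),S)=0$ for all $G\prec F$; the group $\mathrm{Aut}(F)$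 acts on it. For an irreducible representation $V$ of $\mathrm{Aut}_R(M)$ over $K$ and an irreducible representation $U$ of $\mathrm{Aut}(F)$ over $K$ we write $(M,V)\leadsto(F,U)$ (a functor morphing of $V$) if $V$ is a subrepresentation of $KF(M)$ but not of $KG(M)$ for any $G\prec F$, and $\mathrm{Hom}_{\mathrm{Aut}_R(M)}(V,\overline{KF(M)})\cong U^*$ as representations of $\mathrm{Aut}(F)$. It is trivial if $F\cong\mathrm{Hom}_{\mathcal C}(M,-)$ and $U\cong V$ under the induced isomorphism $\mathrm{Aut}(F)\cong\mathrm{Aut}_R(M)$ given by Yoneda's lemma. *Left maximal morphisms.* Let $E_i=\mathrm{End}_R(M_i)/J_i$, where $J_i$ is the Jacobson radical; it is a finite field. A non-zero non-invertible $f:M_j\to M_i$ is left maximal if $gf=0$ for every $k$ and every non-invertible $g:M_i\to M_k$. Together with $0$ these form an $E_i$-vector space $LM(M_j,M_i)$ of dimension $d_{i,j}$; $LM(M,M_i)$ is the set of morphisms $M\to M_i$ all of whose components lie in the spaces $LM(M_j,M_i)$. The LM graph has vertices $1,\dots,n$ and $d_{i,j}$ arrows from $j$ to $i$; $s(e)$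 and $t(e)$ are the source and the target of an arrow $e$. Put $D_i=\sum_j a_jd_{i,j}$ and let $N_i=\{1+\sum_j g_jf_j : f_j\in LM(M,M_i),\ g_j\in\mathrm{Hom}_R(M_i,M)\}$, an abelian normal subgroup of $\mathrm{Aut}_R(M)$. A choice of $E_i$-bases of the spaces $LM(M_j,M_i)$ gives an isomorphism $\theta:N_i\cong \mathrm M_{a_i\times D_i}(E_i)$. Fix a primitive $p$-th root of unity $\zeta\in K$, where $p=\mathrm{char}\,E_i$, and put $\psi(x)=\zeta^{\mathrm{Tr}_{E_i/\mathbb F_p}(x)}$; the characters of $N_i$ are the $\chi_A\circ\theta$ with $\chi_A(B)=\psi(\mathrm{tr}(AB))$ and $A\in \mathrm M_{D_i\times a_i}(E_i)$. The representation $V$ is *degenerate* if for some $i$ and some $A$ with $\mathrm{rank}(A)<D_i$ the character $\chi_A\circ\theta$ occurs in the restriction of $V$ to $N_i$. **Theorem.** Let $V$ be an irreducible representation of $\mathrm{Aut}_R(M)$ over $K$. 1. If $V$ is degenerate, then $V$ admits a non-trivial functor morphing (and does not admit a trivial one). 2. If $V$ admits a trivial functor morphing, then for every $i=1,\dots,n$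 $$\sum_{e:\ t(e)=i} a_{s(e)}\le a_i .$$ -/

import Mathlib

open CategoryTheory

noncomputable section

namespace FunctorMorphing

universe uk uR uK v w w'

/-! ## Indecomposable modules and the residue algebra of the endomorphism ring -/

/-- A module is indecomposable if it is non-zero and is not the direct sum of two non-zero
submodules. -/
class IsIndecomposable (R : Type*) (N : Type*) [Ring R] [AddCommGroup N] [Module R N] : Prop where
  nontrivial : Nontrivial N
  eq_bot_or_eq_bot : ∀ P Q : Submodule R N, IsCompl P Q → P = ⊥ ∨ Q = ⊥

/-- `End_R(N) / J`, where `J` is the Jacobson radical of `End_R(N)`. -/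
def ResidueAlg (R : Type*) (N : Type*) [Ring R] [AddCommGroup N] [Module R N] : Type _ :=
  Module.End R N ⧸ Ring.jacobson (Module.End R N)

section ResidueAlg

variable (R : Type*) (N : Type*) [Ring R] [AddCommGroup N] [Module R N]

instance : Ring (ResidueAlg R N) :=
  inferInstanceAs (Ring (Module.End R N ⧸ Ring.jacobson (Module.End R N)))

/-- The quotient map `End_R(N) → End_R(N) / J`. -/
def toResidue : Module.End R N →+* ResidueAlg R N :=
  Ideal.Quotient.mk (Ring.jacobson (Module.End R N))

theorem toResidue_surjective : Function.Surjective (toResidue R N) :=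
  Ideal.Quotient.mk_surjective

instance [Finite N] : Finite (ResidueAlg R N) :=
  have : Finite (Module.End R N) := DFunLike.finite _
  Finite.of_surjective _ (toResidue_surjective R N)

variable {R N}

theorem toResidue_eq_zero_iff {x : Module.End R N} :
    toResidue R N x = 0 ↔ x ∈ Ring.jacobson (Module.End R N) :=
  Ideal.Quotient.eq_zero_iff_mem

theorem not_bijective_of_mem_jacobson [Nontrivial N] {x : Module.End R N}
    (hx : x ∈ Ring.jacobson (Module.End R N)) : ¬ Function.Bijective x := by
  intro hb
  have hu : IsUnit x := (Module.End.isUnit_iff x).2 hb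
  have h1 := Ideal.eq_top_of_isUnit_mem _ hx hu
  exact absurd h1 (Module.jacobson_lt_top (Module.End R N) (Module.End R N)).ne

theorem isNilpotent_of_not_bijective [Finite N] [IsIndecomposable R N] {x : Module.End R N}
    (hx : ¬ Function.Bijective x) : IsNilpotent x := by
  obtain ⟨m, hm1, hm2⟩ := ((Filter.eventually_ge_atTop 1).and
    x.eventually_isCompl_ker_pow_range_pow).exists
  rcases IsIndecomposable.eq_bot_or_eq_bot _ _ hm2 with h | h
  · exfalso
    apply hx
    apply Finite.injective_iff_bijective.1
    have : Function.Injective (x ^ m) := LinearMap.ker_eq_bot.1 h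
    obtain ⟨m, rfl⟩ : ∃ j, m = j + 1 := ⟨m - 1, by omega⟩
    rw [pow_succ] at this
    exact Function.Injective.of_comp (f := (x ^ m : Module.End R N)) this
  · exact ⟨m, LinearMap.range_eq_bot.1 h⟩

theorem mem_jacobson_of_not_bijective [Finite N] [IsIndecomposable R N] {x : Module.End R N}
    (hx : ¬ Function.Bijective x) : x ∈ Ring.jacobson (Module.End R N) := by
  rw [← Ideal.jacobson_bot, Ideal.mem_jacobson_iff]
  intro y
  have hyx : ¬ Function.Bijective (y * x : Module.End R N) := fun h =>
    hx (Finite.injective_iff_bijective.1 (Function.Injective.of_comp (f := y) h.1))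
  obtain ⟨z, hz⟩ := (isNilpotent_of_not_bijective hyx).isUnit_one_add.exists_left_inv
  refine ⟨z, ?_⟩
  rw [Ideal.mem_bot, sub_eq_zero, ← hz]
  noncomm_ring

instance [Finite N] [IsIndecomposable R N] : Nontrivial (ResidueAlg R N) := by
  have : Nontrivial N := IsIndecomposable.nontrivial R
  refine ⟨1, 0, fun h => ?_⟩
  rw [← map_one (toResidue R N), toResidue_eq_zero_iff] at h
  exact not_bijective_of_mem_jacobson h Function.bijective_id

instance [Finite N] [IsIndecomposable R N] : NoZeroDivisors (ResidueAlg R N) where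
  eq_zero_or_eq_zero_of_mul_eq_zero {a b} hab := by
    obtain ⟨x, rfl⟩ := toResidue_surjective R N a
    obtain ⟨y, rfl⟩ := toResidue_surjective R N b
    by_cases hx : Function.Bijective x
    · right
      obtain ⟨z, hz⟩ := ((Module.End.isUnit_iff x).2 hx).exists_left_inv
      have : toResidue R N y = toResidue R N z * (toResidue R N x * toResidue R N y) := by
        rw [← mul_assoc, ← map_mul, hz, map_one, one_mul]
      rw [this, hab, mul_zero]
    · left
      exact toResidue_eq_zero_iff.2 (mem_jacobson_of_not_bijective hx)

/-- The residue algebra of a finite indecomposable module is a finite division ring, hence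
commutative. -/
instance [Finite N] [IsIndecomposable R N] : CommRing (ResidueAlg R N) :=
  { (inferInstance : Ring (ResidueAlg R N)) with
    mul_comm :=
      have : IsDomain (ResidueAlg R N) := NoZeroDivisors.to_isDomain _
      (Finite.isDomain_to_isField (ResidueAlg R N)).mul_comm }

/-- The residue algebra of a finite indecomposable module is a field. -/
theorem residueAlg_isField [Finite N] [IsIndecomposable R N] : IsField (ResidueAlg R N) :=
  have : IsDomain (ResidueAlg R N) := NoZeroDivisors.to_isDomain _
  Finite.isDomain_to_isField (ResidueAlg R N)

/-- The function `x ↦ ζ ^ Tr(x)` on the residue algebra, where `Tr` is the trace to the prime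
field `ℤ/p`. -/
def psi [Finite N] [IsIndecomposable R N] {K : Type*} [Field K] (ζ : K) (x : ResidueAlg R N) : K :=
  letI : Algebra (ZMod (ringChar (ResidueAlg R N))) (ResidueAlg R N) := ZMod.algebra _ _
  ζ ^ (Algebra.trace (ZMod (ringChar (ResidueAlg R N))) (ResidueAlg R N) x).val

end ResidueAlg

/-! ## Left maximal morphisms -/

section LeftMaximal

variable {R : Type uR} [Ring R] {n : ℕ} (M : Fin n → Type v) [∀ i, AddCommGroup (M i)]
  [∀ i, Module R (M i)]

/-- A morphism `f : M_j → M_i` is left maximal (relative to the family `M`) if it is non-zero,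
not invertible, and `g ∘ f = 0` for all `k` and all non-invertible `g : M_i → M_k`. -/
def IsLeftMaximal {j i : Fin n} (f : M j →ₗ[R] M i) : Prop :=
  f ≠ 0 ∧ ¬ Function.Bijective f ∧
    ∀ (k : Fin n) (g : M i →ₗ[R] M k), ¬ Function.Bijective g → g ∘ₗ f = 0

variable {M} in
theorem comp_eq_zero {j i : Fin n} {f : M j →ₗ[R] M i} (hf : f = 0 ∨ IsLeftMaximal M f)
    {k : Fin n} (g : M i →ₗ[R] M k) (hg : ¬ Function.Bijective g) : g ∘ₗ f = 0 := by
  rcases hf with rfl | hf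
  · exact LinearMap.comp_zero _
  · exact hf.2.2 k g hg

variable (R) in
/-- The group `LM(M_j, M_i)` of left maximal morphisms together with zero. -/
def LM (j i : Fin n) : AddSubgroup (M j →ₗ[R] M i) where
  carrier := {f | f = 0 ∨ IsLeftMaximal M f}
  zero_mem' := Or.inl rfl
  neg_mem' := by
    rintro f (rfl | ⟨h1, h2, h3⟩)
    · exact Or.inl neg_zero
    · refine Or.inr ⟨neg_ne_zero.2 h1, fun h => h2 ?_, fun k g hg => ?_⟩
      · have : Function.Bijective ((LinearEquiv.neg R : M i ≃ₗ[R] M i) ∘ (-f)) :=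
          (LinearEquiv.neg R : M i ≃ₗ[R] M i).bijective.comp h
        convert this using 1
        ext x
        simp
      · rw [LinearMap.comp_neg, h3 k g hg, neg_zero]
  add_mem' := by
    intro f f' hf hf'
    by_cases h0 : f + f' = 0
    · exact Or.inl h0
    refine Or.inr ⟨h0, fun hb => ?_, fun k g hg => ?_⟩
    · let e := LinearEquiv.ofBijective (f + f') hb
      have key : ∀ p : M j →ₗ[R] M i, p = 0 ∨ IsLeftMaximal M p → p = 0 := by
        rintro p (hp | hp)
        · exact hp
        have hnb : ¬ Function.Bijective (p ∘ₗ e.symm.toLinearMap) := by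
          intro h
          apply hp.2.1
          have := h.comp e.bijective
          convert this using 1
          ext x
          simp
        have h1 := comp_eq_zero hf _ hnb
        have h2 := comp_eq_zero hf' _ hnb
        have h3 : (p ∘ₗ e.symm.toLinearMap) ∘ₗ (f + f') = 0 := by
          rw [LinearMap.comp_add, h1, h2, add_zero]
        ext x
        have := LinearMap.congr_fun h3 x
        have he : e.symm ((f + f') x) = x := e.symm_apply_apply x
        simpa only [LinearMap.comp_apply, LinearEquiv.coe_coe, he] using this
      exact h0 (by rw [key f hf, key f' hf', add_zero])
    · rw [LinearMap.comp_add, comp_eq_zero hf g hg, comp_eq_zero hf' g hg, add_zero]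

theorem comp_mem_LM {j i : Fin n} (x : Module.End R (M i)) {f : M j →ₗ[R] M i}
    (hf : f ∈ LM R M j i) : x ∘ₗ f ∈ LM R M j i := by
  by_cases hx : Function.Bijective x
  · rcases hf with rfl | hf
    · exact Or.inl (LinearMap.comp_zero _)
    · by_cases h0 : x ∘ₗ f = 0
      · exact Or.inl h0
      refine Or.inr ⟨h0, fun h => hf.2.1 ?_, fun k g hg => ?_⟩
      · exact (Function.Bijective.of_comp_iff' hx f).1 h
      · rw [← LinearMap.comp_assoc]
        refine hf.2.2 k _ fun h => hg ?_
        exact (Function.Bijective.of_comp_iff g hx).1 h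
  · exact Or.inl (comp_eq_zero hf x hx)

variable (R) in
/-- Post-composition with endomorphisms of `M_i` on `LM(M_j, M_i)`. -/
def postComp (j i : Fin n) : Module.End R (M i) →+* AddMonoid.End (LM R M j i) where
  toFun x :=
    { toFun := fun f => ⟨x ∘ₗ f.1, comp_mem_LM M x f.2⟩
      map_zero' := Subtype.ext (LinearMap.comp_zero _)
      map_add' := fun f g => Subtype.ext (LinearMap.comp_add _ _ _) }
  map_one' := rfl
  map_mul' _ _ := rfl
  map_zero' := DFunLike.ext _ _ fun f => Subtype.ext (LinearMap.zero_comp _)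
  map_add' x y := by ext f; rfl

/-- The action of `E_i = End(M_i) / J_i` on `LM(M_j, M_i)` induced by post-composition. -/
instance (j i : Fin n) : Module (ResidueAlg R (M i)) (LM R M j i) :=
  Module.compHom _ (Ideal.Quotient.lift (Ring.jacobson (Module.End R (M i))) (postComp R M j i)
    (by
      intro x hx
      refine DFunLike.ext _ _ fun f => Subtype.ext ?_
      change x ∘ₗ f.1 = 0
      rcases subsingleton_or_nontrivial (M i) with h | h
      · exact Subsingleton.elim _ _
      · exact comp_eq_zero f.2 x (not_bijective_of_mem_jacobson hx)) :
    ResidueAlg R (M i) →+* AddMonoid.End (LM R M j i))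

theorem toResidue_smul (j i : Fin n) (x : Module.End R (M i)) (f : LM R M j i) :
    ((toResidue R (M i) x • f : LM R M j i) : M j →ₗ[R] M i) = x ∘ₗ f.1 := rfl

variable (R) in
/-- `d_{i,j} = dim_{E_i} LM(M_j, M_i)`, the number of arrows from `j` to `i` in the LM graph. -/
def lmDim (j i : Fin n) : ℕ := Module.finrank (ResidueAlg R (M i)) (LM R M j i)

variable (R) in
/-- The arrows of the LM graph on the vertices `1, …, n`: for all `j` and `i` there are
`dim_{E_i} LM(M_j, M_i)` arrows from `j` to `i`. -/
abbrev LMArrow : Type := Σ p : Fin n × Fin n, Fin (lmDim R M p.1 p.2)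

/-- The source of an arrow of the LM graph. -/
def LMArrow.source (e : LMArrow R M) : Fin n := e.1.1

/-- The target of an arrow of the LM graph. -/
def LMArrow.target (e : LMArrow R M) : Fin n := e.1.2

end LeftMaximal

/-! ## The module `M = M_1^{a_1} ⊕ ⋯ ⊕ M_n^{a_n}` and the subgroups `N_i` of its automorphism group -/

section Subgroups

variable (R : Type uR) [Ring R] {n : ℕ} (M : Fin n → Type v) [∀ i, AddCommGroup (M i)]
  [∀ i, Module R (M i)] (a : Fin n → ℕ)

/-- The direct sum `M_1^{a_1} ⊕ ⋯ ⊕ M_n^{a_n}`. -/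
abbrev DirSum : Type v := ∀ i : Fin n, Fin (a i) → M i

/-- `Aut_R(M_1^{a_1} ⊕ ⋯ ⊕ M_n^{a_n})`. -/
abbrev AutGroup : Type v := DirSum M a ≃ₗ[R] DirSum M a

/-- The inclusion of the `l`-th copy of `M_j`. -/
def incl (j : Fin n) (l : Fin (a j)) : M j →ₗ[R] DirSum M a :=
  LinearMap.single R (fun i => Fin (a i) → M i) j ∘ₗ LinearMap.single R (fun _ => M j) l

/-- The projection to the `l`-th copy of `M_j`. -/
def proj (j : Fin n) (l : Fin (a j)) : DirSum M a →ₗ[R] M j :=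
  LinearMap.proj l ∘ₗ LinearMap.proj j

theorem sum_incl_comp_proj :
    ∑ j, ∑ l, incl R M a j l ∘ₗ proj R M a j l = LinearMap.id := by
  refine LinearMap.ext fun x => funext fun i => funext fun r => ?_
  simp only [LinearMap.sum_apply, LinearMap.comp_apply, Finset.sum_apply, incl, proj,
    LinearMap.proj_apply, LinearMap.coe_single, LinearMap.id_apply]
  rw [Finset.sum_eq_single i, Finset.sum_eq_single r]
  · simp
  · intro l _ hl
    simp [Pi.single_eq_of_ne hl.symm]
  · simp
  · intro j _ hj
    simp [Pi.single_eq_of_ne hj.symm]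
  · simp

theorem proj_comp_incl_same (j : Fin n) (l : Fin (a j)) :
    proj R M a j l ∘ₗ incl R M a j l = LinearMap.id := by
  ext x
  simp [incl, proj]

theorem proj_comp_incl_of_ne (j : Fin n) (l : Fin (a j)) (i : Fin n) (r : Fin (a i))
    (h : (⟨j, l⟩ : Σ j, Fin (a j)) ≠ ⟨i, r⟩) :
    proj R M a j l ∘ₗ incl R M a i r = 0 := by
  ext x
  by_cases hj : j = i
  · subst hj
    have : l ≠ r := fun h' => h (by rw [h'])
    simp [incl, proj, this]
  · simp [incl, proj, hj]

/-- `LM(M, M_i)`: the morphisms `M → M_i` all of whose components are in `LM(M_j, M_i)`. -/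
def LMTotal (i : Fin n) : AddSubgroup (DirSum M a →ₗ[R] M i) where
  carrier := {f | ∀ (j : Fin n) (l : Fin (a j)), f ∘ₗ incl R M a j l ∈ LM R M j i}
  zero_mem' j l := by rw [LinearMap.zero_comp]; exact zero_mem _
  neg_mem' hf j l := by rw [LinearMap.neg_comp]; exact neg_mem (hf j l)
  add_mem' hf hg j l := by rw [LinearMap.add_comp]; exact add_mem (hf j l) (hg j l)

/-- The group of all finite sums `∑ g_j ∘ f_j` with `f_j ∈ LM(M, M_i)` and
`g_j ∈ Hom_R(M_i, M)`. -/
def nilpotentPart (i : Fin n) : AddSubgroup (Module.End R (DirSum M a)) :=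
  AddSubgroup.closure {x | ∃ f ∈ LMTotal R M a i, ∃ g : M i →ₗ[R] DirSum M a, x = g ∘ₗ f}

variable {R M a}

theorem mem_LMTotal {i : Fin n} {f : DirSum M a →ₗ[R] M i} :
    f ∈ LMTotal R M a i ↔ ∀ (j : Fin n) (l : Fin (a j)), f ∘ₗ incl R M a j l ∈ LM R M j i :=
  Iff.rfl

theorem not_bijective_comp {j i : Fin n} [∀ i, IsIndecomposable R (M i)] {f : M j →ₗ[R] M i}
    (hf : f ∈ LM R M j i) (g : M i →ₗ[R] M j) :
    ¬ Function.Bijective (f ∘ₗ g : Module.End R (M i)) := by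
  intro hb
  have : Nontrivial (M i) := IsIndecomposable.nontrivial R
  have hsurj : Function.Surjective f := Function.Surjective.of_comp (g := g) hb.2
  have hc : IsCompl (LinearMap.range g) (LinearMap.ker f) := by
    refine ⟨?_, ?_⟩
    · rw [Submodule.disjoint_def]
      rintro _ ⟨y, rfl⟩ hy
      have : (f ∘ₗ g) y = (f ∘ₗ g) 0 := by
        rw [map_zero]; exact hy
      rw [hb.1 this, map_zero]
    · rw [Submodule.codisjoint_iff_exists_add_eq]
      intro z
      obtain ⟨y, hy⟩ := hb.2 (f z)
      refine ⟨g y, z - g y, ⟨y, rfl⟩, ?_, by abel⟩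
      rw [LinearMap.mem_ker, map_sub, sub_eq_zero]
      exact hy.symm
  rcases IsIndecomposable.eq_bot_or_eq_bot _ _ hc with h | h
  · rw [LinearMap.range_eq_bot] at h
    rw [h, LinearMap.comp_zero] at hb
    obtain ⟨y, hy⟩ := exists_ne (0 : M i)
    exact hy (hb.1 rfl)
  · rcases hf with rfl | hf
    · obtain ⟨y, hy⟩ := exists_ne (0 : M i)
      obtain ⟨z, hz⟩ := hsurj y
      exact hy hz.symm
    · exact hf.2.1 ⟨LinearMap.ker_eq_bot.1 h, hsurj⟩

theorem comp_comp_eq_zero [∀ i, Finite (M i)] [∀ i, IsIndecomposable R (M i)] {i : Fin n}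
    {f f' : DirSum M a →ₗ[R] M i}
    (hf : f ∈ LMTotal R M a i) (hf' : f' ∈ LMTotal R M a i) (g : M i →ₗ[R] DirSum M a) :
    f ∘ₗ g ∘ₗ f' = 0 := by
  have hJ : (f ∘ₗ g : Module.End R (M i)) = ∑ j, ∑ l,
      (f ∘ₗ incl R M a j l) ∘ₗ (proj R M a j l ∘ₗ g) := by
    conv_lhs => rw [← LinearMap.id_comp g, ← sum_incl_comp_proj R M a]
    ext x
    simp [LinearMap.sum_apply, map_sum]
  have : Nontrivial (M i) := IsIndecomposable.nontrivial R
  have hnb : ¬ Function.Bijective (f ∘ₗ g : Module.End R (M i)) := by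
    apply not_bijective_of_mem_jacobson
    rw [hJ]
    exact sum_mem fun j _ => sum_mem fun l _ =>
      mem_jacobson_of_not_bijective (not_bijective_comp (hf j l) _)
  ext1 j
  ext1 l
  exact comp_eq_zero (hf' j l) _ hnb

theorem mul_eq_zero_of_mem [∀ i, Finite (M i)] [∀ i, IsIndecomposable R (M i)] {i : Fin n}
    {x y : Module.End R (DirSum M a)}
    (hx : x ∈ nilpotentPart R M a i) (hy : y ∈ nilpotentPart R M a i) : x * y = 0 := by
  refine AddSubgroup.closure_induction₂ (p := fun x y _ _ => x * y = 0) ?_ ?_ ?_ ?_ ?_ ?_ ?_ hx hy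
  · rintro _ _ ⟨f, hf, g, rfl⟩ ⟨f', hf', g', rfl⟩
    change (g ∘ₗ f) ∘ₗ (g' ∘ₗ f') = 0
    rw [LinearMap.comp_assoc, comp_comp_eq_zero hf hf', LinearMap.comp_zero]
  · intros; exact zero_mul _
  · intros; exact mul_zero _
  · intro x y z _ _ _ h1 h2; rw [add_mul, h1, h2, add_zero]
  · intro x y z _ _ _ h1 h2; rw [mul_add, h1, h2, add_zero]
  · intro x y _ _ h; exact (neg_mul x y).trans (by rw [h, neg_zero])
  · intro x y _ _ h; exact (mul_neg x y).trans (by rw [h, neg_zero])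

theorem incl_comp_mem {i : Fin n} (r : Fin (a i)) (j : Fin n) (l : Fin (a j))
    {f : M j →ₗ[R] M i} (hf : f ∈ LM R M j i) :
    incl R M a i r ∘ₗ f ∘ₗ proj R M a j l ∈ nilpotentPart R M a i := by
  refine AddSubgroup.subset_closure ⟨f ∘ₗ proj R M a j l, mem_LMTotal.2 fun j' l' => ?_, _, rfl⟩
  rw [LinearMap.comp_assoc]
  by_cases h : (⟨j, l⟩ : Σ j, Fin (a j)) = ⟨j', l'⟩
  · cases h
    rw [proj_comp_incl_same, LinearMap.comp_id]
    exact hf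
  · rw [proj_comp_incl_of_ne R M a j l j' l' h, LinearMap.comp_zero]
    exact zero_mem _

theorem one_add_mul_one_sub {A : Type*} [Ring A] {x : A} (h : x * x = 0) :
    (1 + x) * (1 - x) = 1 := by
  rw [add_mul, mul_sub, mul_sub, h]
  simp

theorem one_sub_mul_one_add {A : Type*} [Ring A] {x : A} (h : x * x = 0) :
    (1 - x) * (1 + x) = 1 := by
  rw [sub_mul, mul_add, mul_add, h]
  simp

theorem mul_sub_one_eq {A : Type*} [Ring A] {x y : A} (h : (x - 1) * (y - 1) = 0) :
    x * y - 1 = (x - 1) + (y - 1) := by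
  rw [← add_zero ((x - 1) + (y - 1)), ← h]
  noncomm_ring

theorem inv_sub_one_eq {A : Type*} [Ring A] {x z : A} (h : (x - 1) * (x - 1) = 0)
    (hz : z * x = 1) : z - 1 = -(x - 1) := by
  have h1 : z * ((x - 1) * (x - 1)) = (z * x) * x - z * x - z * x + z := by noncomm_ring
  rw [h, mul_zero, hz, one_mul] at h1
  have h2 : z - 1 = (x - 1 - 1 + z) - (x - 1) := by abel
  rw [h2, ← h1, zero_sub]

variable (R M a)

/-- The endomorphism underlying an automorphism. -/
abbrev toEnd (u : AutGroup R M a) : Module.End R (DirSum M a) := u.toLinearMap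

variable [∀ i, Finite (M i)] [∀ i, IsIndecomposable R (M i)]

/-- The subgroup `N_i = {1 + ∑ g_j f_j | f_j ∈ LM(M, M_i), g_j ∈ Hom(M_i, M)}` of `Aut_R(M)`. -/
def subgroupN (i : Fin n) : Subgroup (AutGroup R M a) where
  carrier := {u | toEnd R M a u - 1 ∈ nilpotentPart R M a i}
  one_mem' := by
    have h : toEnd R M a 1 - 1 = 0 := sub_self _
    exact (congrArg (· ∈ nilpotentPart R M a i) h).mpr (zero_mem _)
  mul_mem' {u u'} hu hu' :=
    (congrArg (· ∈ nilpotentPart R M a i)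
      (mul_sub_one_eq (mul_eq_zero_of_mem hu hu'))).mpr (add_mem hu hu')
  inv_mem' {u} hu :=
    (congrArg (· ∈ nilpotentPart R M a i)
      (inv_sub_one_eq (z := toEnd R M a u⁻¹) (mul_eq_zero_of_mem hu hu)
        (congrArg (toEnd R M a) (inv_mul_cancel u)))).mpr (neg_mem hu)

variable {R M a} in
theorem mem_subgroupN {i : Fin n} {u : AutGroup R M a} :
    u ∈ subgroupN R M a i ↔ toEnd R M a u - 1 ∈ nilpotentPart R M a i := Iff.rfl

/-- The index set of the `D_i = ∑_j a_j d_{i,j}` columns: a copy of some `M_j` together with the index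
of a basis vector of `LM(M_j, M_i)`. -/
abbrev Col (i : Fin n) : Type := Σ j : Fin n, Fin (a j) × Fin (lmDim R M j i)

/-- `D_i = ∑_j a_j d_{i,j}`. -/
def lmTotalDim (i : Fin n) : ℕ := ∑ j, a j * lmDim R M j i

/-- A choice of `E_i`-bases `f^i_{j,1}, …, f^i_{j,d_{i,j}}` of `LM(M_j, M_i)` for all `j`. -/
abbrev LMBasis (i : Fin n) : Type _ :=
  ∀ j : Fin n, Module.Basis (Fin (lmDim R M j i)) (ResidueAlg R (M i)) (LM R M j i)

variable {R M a}

/-- The endomorphism of `M` given by a matrix `B`: its component from the `l`-th copy of `M_j` to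
the `r`-th copy of `M_i` is `∑_k B_{r,(j,l,k)} f^i_{j,k}`; all other components are zero. -/
def matrixToEnd {i : Fin n} (b : LMBasis R M i) :
    Matrix (Fin (a i)) (Col R M a i) (ResidueAlg R (M i)) →+ Module.End R (DirSum M a) where
  toFun B := ∑ r, ∑ c : Col R M a i, incl R M a i r ∘ₗ
    ((B r c • b c.1 c.2.2 : LM R M c.1 i) : M c.1 →ₗ[R] M i) ∘ₗ proj R M a c.1 c.2.1
  map_zero' := by
    refine Finset.sum_eq_zero fun r _ => Finset.sum_eq_zero fun c _ => ?_
    rw [Matrix.zero_apply, zero_smul, AddSubgroup.coe_zero, LinearMap.zero_comp,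
      LinearMap.comp_zero]
  map_add' B B' := by
    simp only [← Finset.sum_add_distrib]
    refine Finset.sum_congr rfl fun r _ => Finset.sum_congr rfl fun c _ => ?_
    rw [Matrix.add_apply, add_smul, AddSubgroup.coe_add, LinearMap.add_comp, LinearMap.comp_add]

theorem matrixToEnd_apply {i : Fin n} (b : LMBasis R M i)
    (B : Matrix (Fin (a i)) (Col R M a i) (ResidueAlg R (M i))) :
    matrixToEnd b B = ∑ r, ∑ c : Col R M a i, incl R M a i r ∘ₗ
      ((B r c • b c.1 c.2.2 : LM R M c.1 i) : M c.1 →ₗ[R] M i) ∘ₗ proj R M a c.1 c.2.1 := rfl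

theorem matrixToEnd_entry {i : Fin n} (b : LMBasis R M i)
    (B : Matrix (Fin (a i)) (Col R M a i) (ResidueAlg R (M i))) (r : Fin (a i)) (j : Fin n)
    (l : Fin (a j)) :
    proj R M a i r ∘ₗ matrixToEnd b B ∘ₗ incl R M a j l =
      ((∑ k, B r ⟨j, l, k⟩ • b j k : LM R M j i) : M j →ₗ[R] M i) := by
  refine LinearMap.ext fun x => ?_
  have hp : ∀ y : M j, proj R M a j l (incl R M a j l y) = y := fun y =>
    LinearMap.congr_fun (proj_comp_incl_same R M a j l) y
  have hp' : ∀ (j' : Fin n) (l' : Fin (a j')) (y : M j),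
      (⟨j, l⟩ : Σ j, Fin (a j)) ≠ ⟨j', l'⟩ → proj R M a j' l' (incl R M a j l y) = 0 :=
    fun j' l' y h => LinearMap.congr_fun (proj_comp_incl_of_ne R M a j' l' j l (Ne.symm h)) y
  have hq : ∀ (r' : Fin (a i)) (y : M i), proj R M a i r (incl R M a i r' y) =
      if r' = r then y else 0 := by
    intro r' y
    split_ifs with h
    · cases h
      exact LinearMap.congr_fun (proj_comp_incl_same R M a i r) y
    · exact LinearMap.congr_fun (proj_comp_incl_of_ne R M a i r i r'
        (fun h' => h (by cases h'; rfl))) y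
  rw [matrixToEnd_apply]
  simp only [LinearMap.comp_apply, LinearMap.sum_apply, map_sum, hq]
  rw [Finset.sum_eq_single r (fun r' _ hr' => by simp [hr']) (by simp)]
  simp only [if_true]
  rw [Fintype.sum_sigma, Finset.sum_eq_single j _ (by simp), Fintype.sum_prod_type,
    Finset.sum_eq_single l _ (by simp)]
  · simp only [AddSubgroup.val_finsetSum, LinearMap.sum_apply]
    refine Finset.sum_congr rfl fun k _ => ?_
    rw [hp]
  · intro l' _ hl'
    refine Finset.sum_eq_zero fun k _ => ?_
    rw [hp' _ _ _ (fun h => hl' (by cases h; rfl)), map_zero]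
  · intro j' _ hj'
    refine Finset.sum_eq_zero fun k _ => ?_
    rw [hp' _ _ _ (fun h => hj' (by cases h; rfl)), map_zero]

theorem matrixToEnd_injective {i : Fin n} (b : LMBasis R M i) :
    Function.Injective (matrixToEnd (a := a) b) := by
  rw [injective_iff_map_eq_zero]
  intro B hB
  ext r ⟨j, l, k⟩
  have h := matrixToEnd_entry b B r j l
  rw [hB, LinearMap.zero_comp, LinearMap.comp_zero] at h
  have h2 : (∑ k, B r ⟨j, l, k⟩ • b j k : LM R M j i) = 0 := Subtype.ext h.symm
  exact (Fintype.linearIndependent_iff.1 (b j).linearIndependent) _ h2 k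

theorem matrixToEnd_mem {i : Fin n} (b : LMBasis R M i)
    (B : Matrix (Fin (a i)) (Col R M a i) (ResidueAlg R (M i))) :
    matrixToEnd b B ∈ nilpotentPart R M a i := by
  rw [matrixToEnd_apply]
  exact sum_mem fun r _ => sum_mem fun c _ => incl_comp_mem r c.1 c.2.1 (B r c • b c.1 c.2.2).2

theorem mem_range_matrixToEnd (hM : ∀ i j, i ≠ j → IsEmpty (M i ≃ₗ[R] M j)) {i : Fin n}
    (b : LMBasis R M i) {x : Module.End R (DirSum M a)} (hx : x ∈ nilpotentPart R M a i) :
    x ∈ (matrixToEnd (a := a) b).range := by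
  refine (AddSubgroup.closure_le _).2 ?_ hx
  rintro _ ⟨f, hf, g, rfl⟩
  refine ⟨Matrix.of fun r (c : Col R M a i) => toResidue R (M i) (proj R M a i r ∘ₗ g) *
    (b c.1).repr ⟨f ∘ₗ incl R M a c.1 c.2.1, mem_LMTotal.1 hf c.1 c.2.1⟩ c.2.2, ?_⟩
  have hgf : g ∘ₗ f = ∑ r, ∑ j, ∑ l, incl R M a i r ∘ₗ
      ((proj R M a i r ∘ₗ g) ∘ₗ (f ∘ₗ incl R M a j l)) ∘ₗ proj R M a j l := by
    have h1 : g ∘ₗ f = ∑ i', ∑ r, ∑ j, ∑ l, incl R M a i' r ∘ₗ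
        ((proj R M a i' r ∘ₗ g) ∘ₗ (f ∘ₗ incl R M a j l)) ∘ₗ proj R M a j l := by
      conv_lhs => rw [← LinearMap.id_comp g, ← LinearMap.comp_id f, ← sum_incl_comp_proj R M a]
      ext x
      simp [map_sum]
    rw [h1]
    refine Finset.sum_eq_single i (fun i' _ hi' => ?_) (by simp)
    refine Finset.sum_eq_zero fun r _ => Finset.sum_eq_zero fun j _ =>
      Finset.sum_eq_zero fun l _ => ?_
    rw [comp_eq_zero (hf j l) _ (fun hb => (hM i i' hi'.symm).false
      (LinearEquiv.ofBijective _ hb)), LinearMap.zero_comp, LinearMap.comp_zero]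
  rw [hgf, matrixToEnd_apply]
  simp only [Matrix.of_apply]
  refine Finset.sum_congr rfl fun r _ => ?_
  rw [Fintype.sum_sigma]
  refine Finset.sum_congr rfl fun j _ => ?_
  rw [Fintype.sum_prod_type]
  refine Finset.sum_congr rfl fun l _ => ?_
  have h2 : (∑ k, (toResidue R (M i) (proj R M a i r ∘ₗ g) *
      (b j).repr ⟨f ∘ₗ incl R M a j l, mem_LMTotal.1 hf j l⟩ k) • b j k : LM R M j i) =
      toResidue R (M i) (proj R M a i r ∘ₗ g) • ⟨f ∘ₗ incl R M a j l, mem_LMTotal.1 hf j l⟩ := by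
    conv_rhs => rw [← (b j).sum_repr ⟨f ∘ₗ incl R M a j l, mem_LMTotal.1 hf j l⟩, Finset.smul_sum]
    simp only [mul_smul]
  have h3 := congrArg Subtype.val h2
  rw [toResidue_smul] at h3
  change _ = (proj R M a i r ∘ₗ g) ∘ₗ (f ∘ₗ incl R M a j l) at h3
  rw [← h3]
  ext x
  simp [map_sum]

/-- The automorphism `1 + x` for an element `x` of `nilpotentPart`. -/
def oneAdd {i : Fin n} (x : nilpotentPart R M a i) : subgroupN R M a i :=
  ⟨LinearEquiv.ofLinearMap (1 + x.1) (1 - x.1)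
    (one_add_mul_one_sub (mul_eq_zero_of_mem x.2 x.2))
    (one_sub_mul_one_add (mul_eq_zero_of_mem x.2 x.2)),
    mem_subgroupN.2 ((congrArg (· ∈ nilpotentPart R M a i) (add_sub_cancel_left 1 x.1)).mpr x.2)⟩

/-- The element `u - 1` of `nilpotentPart` for an element `u` of `N_i`. -/
def subOne {i : Fin n} (u : subgroupN R M a i) : nilpotentPart R M a i :=
  ⟨toEnd R M a u.1 - 1, mem_subgroupN.1 u.2⟩

theorem oneAdd_subOne {i : Fin n} (u : subgroupN R M a i) : oneAdd (subOne u) = u :=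
  Subtype.ext (LinearEquiv.toLinearMap_injective
    (add_sub_cancel (1 : Module.End R (DirSum M a)) (toEnd R M a u.1)))

theorem subOne_oneAdd {i : Fin n} (x : nilpotentPart R M a i) : subOne (oneAdd x) = x :=
  Subtype.ext (add_sub_cancel_left (1 : Module.End R (DirSum M a)) x.1)

theorem subOne_mul {i : Fin n} (u u' : subgroupN R M a i) :
    subOne (u * u') = subOne u + subOne u' :=
  Subtype.ext (mul_sub_one_eq (mul_eq_zero_of_mem (subOne u).2 (subOne u').2))

/-- The isomorphism between the additive group of matrices and `nilpotentPart`. -/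
def matrixEquiv (hM : ∀ i j, i ≠ j → IsEmpty (M i ≃ₗ[R] M j)) {i : Fin n} (b : LMBasis R M i) :
    Matrix (Fin (a i)) (Col R M a i) (ResidueAlg R (M i)) ≃+ nilpotentPart R M a i :=
  AddEquiv.ofBijective ((matrixToEnd b).codRestrict (nilpotentPart R M a i) (matrixToEnd_mem b))
    ⟨fun _ _ h => matrixToEnd_injective b (congrArg Subtype.val h),
      fun x => by
        obtain ⟨B, hB⟩ := mem_range_matrixToEnd hM b x.2
        exact ⟨B, Subtype.ext hB⟩⟩

/-- The isomorphism `θ : N_i ≅ M_{a_i × D_i}(E_i)`, which sends `1 + x` to the matrix of `x` with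
respect to the chosen bases. -/
def theta (hM : ∀ i j, i ≠ j → IsEmpty (M i ≃ₗ[R] M j)) {i : Fin n} (b : LMBasis R M i) :
    subgroupN R M a i ≃*
      Multiplicative (Matrix (Fin (a i)) (Col R M a i) (ResidueAlg R (M i))) where
  toFun u := Multiplicative.ofAdd ((matrixEquiv hM b).symm (subOne u))
  invFun B := oneAdd (matrixEquiv hM b B.toAdd)
  left_inv u := by
    simp only [toAdd_ofAdd, AddEquiv.apply_symm_apply, oneAdd_subOne]
  right_inv B := by
    simp only [subOne_oneAdd, AddEquiv.symm_apply_apply, ofAdd_toAdd]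
  map_mul' u u' := by
    rw [subOne_mul, map_add, ofAdd_add]

/-- The linear character `χ_A(B) = ψ(tr(AB))` of `M_{a_i × D_i}(E_i)`. -/
def chi {K : Type uK} [Field K] {i : Fin n} (ζ : K)
    (A : Matrix (Col R M a i) (Fin (a i)) (ResidueAlg R (M i)))
    (B : Matrix (Fin (a i)) (Col R M a i) (ResidueAlg R (M i))) : K :=
  psi ζ (A * B).trace

/-- A representation of `Aut_R(M)` is degenerate if for some `i` the character `χ_A ∘ θ` of `N_i`
given by a matrix `A ∈ M_{D_i × a_i}(E_i)` of rank `< D_i` occurs in its restriction to `N_i`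
(with respect to some choice of the bases of the spaces `LM(M_j, M_i)` and of the primitive root of
unity `ζ` that are used to define `θ` and `ψ`). -/
def IsDegenerate (hM : ∀ i j, i ≠ j → IsEmpty (M i ≃ₗ[R] M j)) {K : Type uK} [Field K]
    {V : Type w} [AddCommGroup V] [Module K V] (ρ : Representation K (AutGroup R M a) V) : Prop :=
  ∃ (i : Fin n) (b : LMBasis R M i) (ζ : K)
    (A : Matrix (Col R M a i) (Fin (a i)) (ResidueAlg R (M i))),
    IsPrimitiveRoot ζ (ringChar (ResidueAlg R (M i))) ∧
    (∃ v : V, v ≠ 0 ∧ ∀ u : subgroupN R M a i,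
      ρ u v = chi ζ A (theta hM b u).toAdd • v) ∧
    A.rank < lmTotalDim R M a i

end Subgroups

/-! ## The category `C = ⟨M_1, …, M_n⟩` and the functor category `C_{+1}` -/

section Functors

open scoped ModuleCat.Algebra

variable (R : Type uR) [Ring R] {n : ℕ} (M : Fin n → Type v) [∀ i, AddCommGroup (M i)]
  [∀ i, Module R (M i)]

/-- The modules isomorphic to `M_1^{b_1} ⊕ ⋯ ⊕ M_n^{b_n}` for some `b_1, …, b_n`. -/
def isDirSum : ObjectProperty (ModuleCat.{v} R) :=
  fun X => ∃ b : Fin n → ℕ, Nonempty (X ≃ₗ[R] DirSum M b)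

/-- The category `C = ⟨M_1, …, M_n⟩`, a full subcategory of the category of `R`-modules. -/
abbrev AddCat : Type _ := (isDirSum R M).FullSubcategory

/-- The object `M_1^{a_1} ⊕ ⋯ ⊕ M_n^{a_n}` of `C`. -/
def dirSumObj (a : Fin n → ℕ) : AddCat R M :=
  ⟨ModuleCat.of R (DirSum M a), a, ⟨LinearEquiv.refl R _⟩⟩

/-- An automorphism of the module `M_1^{a_1} ⊕ ⋯ ⊕ M_n^{a_n}` as a morphism of `C`. -/
def autHom {a : Fin n → ℕ} (g : AutGroup R M a) : dirSumObj R M a ⟶ dirSumObj R M a :=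
  ObjectProperty.homMk (ModuleCat.ofHom g.toLinearMap)

theorem autHom_one {a : Fin n → ℕ} : autHom R M (1 : AutGroup R M a) = 𝟙 _ := rfl

theorem autHom_mul {a : Fin n → ℕ} (g h : AutGroup R M a) :
    autHom R M (g * h) = autHom R M h ≫ autHom R M g := rfl

variable (k : Type uk) [CommRing k] [Algebra k R]

/-- The category `C_{+1}` of `k`-linear functors from `C` to `k`-modules. -/
abbrev FunCat : Type _ :=
  ObjectProperty.FullSubcategory
    (fun F : AddCat R M ⥤ ModuleCat.{v} k => F.Additive ∧ F.Linear k)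

/-- The functor `Hom_C(M_1^{a_1} ⊕ ⋯ ⊕ M_n^{a_n}, -)`. -/
def homFunctor (a : Fin n → ℕ) : FunCat R M k :=
  ⟨(linearCoyoneda k (AddCat R M)).obj (Opposite.op (dirSumObj R M a)),
    inferInstance, ⟨fun {X Y} f r => by
      ext g
      exact Linear.comp_smul (R := k) (dirSumObj R M a) X Y g r f⟩⟩

/-- The endomorphism `φ ↦ φ ∘ f` of `Hom_C(M, -)` for an endomorphism `f` of `M`. -/
def homFunctorMap {a : Fin n → ℕ} (f : dirSumObj R M a ⟶ dirSumObj R M a) :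
    homFunctor R M k a ⟶ homFunctor R M k a :=
  ObjectProperty.homMk ((linearCoyoneda k (AddCat R M)).map f.op)

theorem homFunctorMap_id {a : Fin n → ℕ} :
    homFunctorMap R M k (𝟙 (dirSumObj R M a)) = 𝟙 (homFunctor R M k a) :=
  ObjectProperty.hom_ext _ ((linearCoyoneda k (AddCat R M)).map_id _)

theorem homFunctorMap_comp {a : Fin n → ℕ} (f g : dirSumObj R M a ⟶ dirSumObj R M a) :
    homFunctorMap R M k (f ≫ g) = homFunctorMap R M k g ≫ homFunctorMap R M k f :=
  ObjectProperty.hom_ext _ ((linearCoyoneda k (AddCat R M)).map_comp g.op f.op)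

/-- The homomorphism (in fact isomorphism) `Aut_R(M) → Aut(Hom_C(M, -))` of Yoneda's lemma,
`g ↦ (φ ↦ φ ∘ g⁻¹)`. -/
def yonedaAut (a : Fin n → ℕ) : AutGroup R M a →* Aut (homFunctor R M k a) where
  toFun g :=
    { hom := homFunctorMap R M k (autHom R M g⁻¹)
      inv := homFunctorMap R M k (autHom R M g)
      hom_inv_id := by
        rw [← homFunctorMap_comp, ← autHom_mul, inv_mul_cancel, autHom_one, homFunctorMap_id]
      inv_hom_id := by
        rw [← homFunctorMap_comp, ← autHom_mul, mul_inv_cancel, autHom_one, homFunctorMap_id] }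
  map_one' := by
    refine Iso.ext ?_
    change homFunctorMap R M k (autHom R M 1⁻¹) = 𝟙 _
    rw [inv_one, autHom_one, homFunctorMap_id]
  map_mul' g h := by
    refine Iso.ext ?_
    change homFunctorMap R M k (autHom R M (g * h)⁻¹) =
      homFunctorMap R M k (autHom R M h⁻¹) ≫ homFunctorMap R M k (autHom R M g⁻¹)
    rw [mul_inv_rev, autHom_mul, homFunctorMap_comp]

variable {R M k}

/-- `F ≼ G`: the functor `F` is isomorphic to a subquotient of `G`. -/
def IsSubquotient (F G : FunCat R M k) : Prop :=
  ∃ (H : FunCat R M k) (i : H ⟶ G) (p : H ⟶ F),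
    (∀ X, Function.Injective (i.hom.app X)) ∧ (∀ X, Function.Surjective (p.hom.app X))

/-- `F ≺ G`: `F ≼ G` and `F` is not isomorphic to `G`. -/
def IsProperSubquotient (F G : FunCat R M k) : Prop :=
  IsSubquotient F G ∧ IsEmpty (F ≅ G)

/-! ## The representations `KF(M)` and functor morphing -/

variable {a : Fin n → ℕ} {K : Type uK} [Field K]

variable (a K) in
/-- The permutation representation `KF(M)` of `Aut_R(M)` with basis `F(M)`. -/
def permRep (F : FunCat R M k) :
    Representation K (AutGroup R M a) (F.obj.obj (dirSumObj R M a) →₀ K) where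
  toFun g := Finsupp.lmapDomain K K (F.obj.map (autHom R M g))
  map_one' := by
    ext
    simp [autHom_one]
  map_mul' g h := by
    ext
    simp [autHom_mul]

variable (a K) in
/-- The action of `Aut(F)` on `KF(M)`, `u_x ↦ u_{α_M(x)}`. -/
def autRep (F : FunCat R M k) :
    Representation K (Aut F) (F.obj.obj (dirSumObj R M a) →₀ K) where
  toFun α := Finsupp.lmapDomain K K (α.hom.hom.app (dirSumObj R M a))
  map_one' := Finsupp.lmapDomain_id K K
  map_mul' α β := Finsupp.lmapDomain_comp K K (β.hom.hom.app (dirSumObj R M a))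
    (α.hom.hom.app (dirSumObj R M a))

theorem autRep_permRep_comm (F : FunCat R M k) (α : Aut F) (g : AutGroup R M a)
    (x : F.obj.obj (dirSumObj R M a) →₀ K) :
    autRep a K F α (permRep a K F g x) = permRep a K F g (autRep a K F α x) := by
  change Finsupp.mapDomain _ (Finsupp.mapDomain _ x) = Finsupp.mapDomain _ (Finsupp.mapDomain _ x)
  rw [← Finsupp.mapDomain_comp, ← Finsupp.mapDomain_comp]
  congr 1
  funext y
  exact NatTrans.naturality_apply α.hom.hom (autHom R M g) y

/-- A representation `V` of `Aut_R(M)` is a subrepresentation of `KF(M)`. -/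
def OccursIn {V : Type w} [AddCommGroup V] [Module K V]
    (ρ : Representation K (AutGroup R M a) V) (F : FunCat R M k) : Prop :=
  ∃ f : ρ.IntertwiningMap (permRep a K F), Function.Injective f

/-- `V` is `F`-typical: it is a subrepresentation of `KF(M)` but not of `KG(M)` for any `G ≺ F`. -/
def IsTypical {V : Type w} [AddCommGroup V] [Module K V]
    (ρ : Representation K (AutGroup R M a) V) (F : FunCat R M k) : Prop :=
  OccursIn ρ F ∧ ∀ G : FunCat R M k, IsProperSubquotient G F → ¬ OccursIn ρ G

/-- A subrepresentation `S` of `KF(M)` with `Hom(KG(M), S) = 0` for all `G ≺ F`. -/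
def HasNoLowerMaps {F : FunCat R M k} (S : Subrepresentation (permRep a K F)) : Prop :=
  ∀ G : FunCat R M k, IsProperSubquotient G F →
    ∀ f : (permRep a K G).IntertwiningMap S.toRepresentation, f = 0

variable (a K) in
/-- The set of subrepresentations `S` of `KF(M)` with `Hom(KG(M), S) = 0` for all `G ≺ F`. -/
def noLowerSet (F : FunCat R M k) : Set (Submodule K (F.obj.obj (dirSumObj R M a) →₀ K)) :=
  {P | ∃ S : Subrepresentation (permRep a K F), HasNoLowerMaps S ∧ P = S.toSubmodule}

variable (a K) in
/-- The representation `\overline{KF(M)}`: the largest subrepresentation `S` of `KF(M)` with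
`Hom(KG(M), S) = 0` for all `G ≺ F`. -/
def permBar (F : FunCat R M k) : Subrepresentation (permRep a K F) where
  toSubmodule := sSup (noLowerSet a K F)
  apply_mem_toSubmodule g v hv := by
    rw [← Submodule.mem_comap]
    revert v
    change sSup _ ≤ Submodule.comap (permRep a K F g) _
    refine sSup_le ?_
    rintro _ ⟨S, hS, rfl⟩ x hx
    exact le_sSup (show S.toSubmodule ∈ noLowerSet a K F from ⟨S, hS, rfl⟩) (S.apply_mem_toSubmodule g hx)

/-- The image of a subrepresentation of `KF(M)` under an automorphism of `F`. -/
def autImage {F : FunCat R M k} (α : Aut F) (S : Subrepresentation (permRep a K F)) :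
    Subrepresentation (permRep a K F) where
  toSubmodule := S.toSubmodule.map (autRep a K F α)
  apply_mem_toSubmodule g := by
    rintro _ ⟨x, hx, rfl⟩
    exact ⟨permRep a K F g x, S.apply_mem_toSubmodule g hx, autRep_permRep_comm F α g x⟩

theorem hasNoLowerMaps_autImage {F : FunCat R M k} (α : Aut F)
    {S : Subrepresentation (permRep a K F)} (hS : HasNoLowerMaps S) :
    HasNoLowerMaps (autImage α S) := by
  intro G hG f
  have hmem : ∀ y ∈ (autImage α S).toSubmodule, autRep a K F α⁻¹ y ∈ S.toSubmodule := by
    rintro _ ⟨x, hx, rfl⟩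
    rwa [Representation.inv_self_apply]
  let f' : (permRep a K G).IntertwiningMap S.toRepresentation :=
    { toLinearMap := ((autRep a K F α⁻¹).restrict hmem) ∘ₗ f.toLinearMap
      isIntertwining' := fun g => by
        refine LinearMap.ext fun x => Subtype.ext ?_
        change autRep a K F α⁻¹ (f (permRep a K G g x)).1 =
          permRep a K F g (autRep a K F α⁻¹ (f x).1)
        rw [f.isIntertwining, ← autRep_permRep_comm]
        rfl }
  have h0 := hS G hG f'
  refine Representation.IntertwiningMap.ext (LinearMap.ext fun x => Subtype.ext ?_)
  have h1 : autRep a K F α⁻¹ (f x).1 = 0 :=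
    congrArg (fun h : (permRep a K G).IntertwiningMap S.toRepresentation => (h x).1) h0
  have h2 := congrArg (autRep a K F α) h1
  rw [Representation.self_inv_apply, map_zero] at h2
  exact h2

theorem autRep_mem_permBar {F : FunCat R M k} (α : Aut F)
    {x : F.obj.obj (dirSumObj R M a) →₀ K} (hx : x ∈ (permBar a K F).toSubmodule) :
    autRep a K F α x ∈ (permBar a K F).toSubmodule := by
  rw [← Submodule.mem_comap]
  revert x
  change sSup _ ≤ Submodule.comap (autRep a K F α) (permBar a K F).toSubmodule
  refine sSup_le ?_
  rintro _ ⟨S, hS, rfl⟩ y hy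
  have h : (autImage α S).toSubmodule ∈ noLowerSet a K F :=
    ⟨autImage α S, hasNoLowerMaps_autImage α hS, rfl⟩
  exact le_sSup h ⟨y, hy, rfl⟩

/-- The multiplicity space `W = Hom_{Aut_R(M)}(V, \overline{KF(M)})` of `V` in `\overline{KF(M)}`,
as a representation of `Aut(F)` acting on `\overline{KF(M)}`. -/
def multRep {V : Type w} [AddCommGroup V] [Module K V]
    (ρ : Representation K (AutGroup R M a) V) (F : FunCat R M k) :
    Representation K (Aut F) (ρ.IntertwiningMap (permBar a K F).toRepresentation) where
  toFun α :=
    { toFun := fun f =>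
        { toLinearMap :=
            ((autRep a K F α).restrict fun _ hx => autRep_mem_permBar α hx) ∘ₗ f.toLinearMap
          isIntertwining' := fun g => by
            refine LinearMap.ext fun x => Subtype.ext ?_
            change autRep a K F α (f (ρ g x)).1 = permRep a K F g (autRep a K F α (f x).1)
            rw [f.isIntertwining, ← autRep_permRep_comm]
            rfl }
      map_add' := fun f f' => by
        refine Representation.IntertwiningMap.ext (LinearMap.ext fun x => Subtype.ext ?_)
        exact map_add (autRep a K F α) (f x).1 (f' x).1
      map_smul' := fun c f => by
        refine Representation.IntertwiningMap.ext (LinearMap.ext fun x => Subtype.ext ?_)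
        exact map_smul (autRep a K F α) c (f x).1 }
  map_one' := by
    refine LinearMap.ext fun f => Representation.IntertwiningMap.ext
      (LinearMap.ext fun x => Subtype.ext ?_)
    exact LinearMap.congr_fun (map_one (autRep a K F)) (f x).1
  map_mul' α β := by
    refine LinearMap.ext fun f => Representation.IntertwiningMap.ext
      (LinearMap.ext fun x => Subtype.ext ?_)
    exact LinearMap.congr_fun (map_mul (autRep a K F) α β) (f x).1

/-- The functor morphing `(M, V) ⇝ (F, U)`: `V` is `F`-typical and `U` is the irreducible
representation of `Aut(F)` such that the multiplicity space of `V` in `\overline{KF(M)}` is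
isomorphic to the dual of `U`. -/
def FunctorMorphs {V : Type w} [AddCommGroup V] [Module K V]
    (ρ : Representation K (AutGroup R M a) V) (F : FunCat R M k)
    {U : Type w'} [AddCommGroup U] [Module K U] (σ : Representation K (Aut F) U) : Prop :=
  IsTypical ρ F ∧ σ.IsIrreducible ∧ Nonempty ((multRep ρ F).Equiv σ.dual)

/-- `(F, U)` is `(Hom_C(M, -), V)`: there is an isomorphism `F ≅ Hom_C(M, -)` such that `U`
becomes isomorphic to `V` under the resulting `Aut_R(M) ≅ Aut(Hom_C(M, -)) ≅ Aut(F)`. -/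
def IsTrivialPair {V : Type w} [AddCommGroup V] [Module K V]
    (ρ : Representation K (AutGroup R M a) V) (F : FunCat R M k)
    {U : Type w'} [AddCommGroup U] [Module K U] (σ : Representation K (Aut F) U) : Prop :=
  ∃ e : homFunctor R M k a ≅ F,
    Nonempty (Representation.Equiv
      (σ.comp (e.conjAut.toMonoidHom.comp (yonedaAut R M k a))) ρ)

variable (k)

/-- `V` admits a trivial functor morphing: `(M, V) ⇝ (F, U)` with `F = Hom_C(M, -)` and `U = V`. -/
def AdmitsTrivialFunctorMorphing {V : Type w} [AddCommGroup V] [Module K V]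
    (ρ : Representation K (AutGroup R M a) V) : Prop :=
  ∃ (F : FunCat R M k) (U : Type (max v w uK)) (_ : AddCommGroup U) (_ : Module K U)
    (σ : Representation K (Aut F) U), FunctorMorphs ρ F σ ∧ IsTrivialPair ρ F σ

/-- `V` admits a non-trivial functor morphing: `(M, V) ⇝ (F, U)` where it is not the case that
`F = Hom_C(M, -)` and `U = V`. -/
def AdmitsNontrivialFunctorMorphing {V : Type w} [AddCommGroup V] [Module K V]
    (ρ : Representation K (AutGroup R M a) V) : Prop :=
  ∃ (F : FunCat R M k) (U : Type (max v w uK)) (_ : AddCommGroup U) (_ : Module K U)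
    (σ : Representation K (Aut F) U), FunctorMorphs ρ F σ ∧ ¬ IsTrivialPair ρ F σ

end Functors

end FunctorMorphing

end

/-! Two independent facts give the theorem: every irreducible `V` admits some functor morphing, and
a degenerate `V` cannot be typical for `Hom_C(M, -)`.

Existence. The stabilizer of the identity in `Hom_C(M, M)` is trivial, so `V` occurs in `KF(M)` for
`F = Hom_C(M, -)`. Among the functors with finite values in which `V` occurs, one of least size at
`M_1 ⊕ ⋯ ⊕ M_n` is a functor `F` for which `V` is typical, since this size drops strictly for proper
subquotients (`exists_isTypical`). It remains to see that the multiplicity space of `V` in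
`\overline{KF(M)}` is irreducible over `Aut(F)` (`IsTypical.isIrreducible_multRep`); its dual is
then the required `U`.

Irreducibility means that each equivariant `T` on `KF(M)`, applied after an embedding `f` of `V`,
lies in the span of the translates `α ∘ f` with `α ∈ Aut(F)` (`IsTypical.comp_mem`). With `A =
End_R(M)`, the operators commuting with the unit group of `A` are spanned by the relations attached
to cyclic submodules of `F(M) × F(M)` (`mem_of_sum_span_mem`). This rests on the fact that two
generators of a cyclic module over a finite ring differ by a unit (`exists_unit_smul_eq`). Such a
submodule is the value at `M` of a subfunctor of `F ⊕ F` generated by one pair. As in Goursat's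
lemma, either that subfunctor is the graph of an automorphism of `F`, or it involves a proper
subfunctor or a proper quotient of `F`, and then its operator kills `f(V)` by typicality.

Degeneracy. A matrix `A` of rank less than `D_i` has a non-zero left null vector, which is the
coordinate vector of a non-zero `f : M → M_i` in `LM(M, M_i)`. The character of `A` is trivial on
all `1 + h f`, so an eigenvector for it is fixed by them (`IsDegenerate.exists_fixed`). These
elements form the stabilizer of the class of the identity in the quotient of `Hom_C(M, -)` by the
morphisms factoring through `f`. So `V` occurs in a proper quotient of `Hom_C(M, -)`, and no trivial
morphing exists; the morphing that does exist is non-trivial.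

For the inequality: if `D_i > a_i`, every matrix with `a_i` columns has rank less than `D_i`, so
every non-zero representation is degenerate (`isDegenerate_of_lt`). -/

noncomputable section

namespace FunctorMorphing

universe uk uR uK v w

/-! ## Averaging and representations of finite groups -/

section Averaging

variable {K G V W : Type*} [Field K] [Group G] [AddCommGroup V] [Module K V]
  [AddCommGroup W] [Module K W] (ρ : Representation K G V) (σ : Representation K G W)

/-- The sum of all conjugates of a linear map between two representations of a finite group. -/
def sumConj [Fintype G] (l : V →ₗ[K] W) : ρ.IntertwiningMap σ where
  toLinearMap := ∑ g, σ g ∘ₗ l ∘ₗ ρ g⁻¹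
  isIntertwining' h := by
    ext v
    simp only [LinearMap.comp_apply, LinearMap.sum_apply, map_sum]
    refine Fintype.sum_equiv (Equiv.mulLeft h⁻¹) _ _ fun g => ?_
    simp only [Equiv.coe_mulLeft, mul_inv_rev, inv_inv, map_mul, Module.End.mul_apply,
      Representation.self_inv_apply]

theorem sumConj_apply [Fintype G] (l : V →ₗ[K] W) (v : V) :
    sumConj ρ σ l v = ∑ g, σ g (l (ρ g⁻¹ v)) := by
  change (∑ g, σ g ∘ₗ l ∘ₗ ρ g⁻¹) v = _
  simp [LinearMap.sum_apply]

variable {ρ σ} [Finite G] [CharZero K]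

/-- Maschke's argument: every conjugate of a linear retraction of `f` is again a retraction, so the
sum of the conjugates divided by the group order is an equivariant one. -/
theorem exists_intertwining_leftInverse (f : ρ.IntertwiningMap σ) (hf : Function.Injective f) :
    ∃ r : σ.IntertwiningMap ρ, ∀ v, r (f v) = v := by
  have := Fintype.ofFinite G
  obtain ⟨l, hl⟩ := f.toLinearMap.exists_leftInverse_of_injective (LinearMap.ker_eq_bot.2 hf)
  have hl' : ∀ v, l (f v) = v := LinearMap.congr_fun hl
  refine ⟨(Fintype.card G : K)⁻¹ • sumConj σ ρ l, fun v => ?_⟩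
  rw [Representation.IntertwiningMap.smul_apply, sumConj_apply]
  simp only [← f.isIntertwining, hl', Representation.self_inv_apply]
  rw [Finset.sum_const, Finset.card_univ, ← Nat.cast_smul_eq_nsmul K, smul_smul,
    inv_mul_cancel₀ (Nat.cast_ne_zero.2 Fintype.card_ne_zero), one_smul]

theorem exists_intertwining_rightInverse (f : ρ.IntertwiningMap σ)
    (hf : Function.Surjective f) : ∃ s : σ.IntertwiningMap ρ, ∀ w, f (s w) = w := by
  have := Fintype.ofFinite G
  obtain ⟨l, hl⟩ := f.toLinearMap.exists_rightInverse_of_surjective (LinearMap.range_eq_top.2 hf)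
  have hl' : ∀ v, f (l v) = v := LinearMap.congr_fun hl
  refine ⟨(Fintype.card G : K)⁻¹ • sumConj σ ρ l, fun v => ?_⟩
  rw [Representation.IntertwiningMap.smul_apply, sumConj_apply, map_smul, map_sum]
  simp only [f.isIntertwining, hl', Representation.self_inv_apply]
  rw [Finset.sum_const, Finset.card_univ, ← Nat.cast_smul_eq_nsmul K, smul_smul,
    inv_mul_cancel₀ (Nat.cast_ne_zero.2 Fintype.card_ne_zero), one_smul]

/-- A representation with a non-zero intertwining map to an irreducible representation `ρ`
contains `ρ`. -/
theorem exists_injective_of_ne_zero [ρ.IsIrreducible] (f : σ.IntertwiningMap ρ) (hf : f ≠ 0) :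
    ∃ s : ρ.IntertwiningMap σ, Function.Injective s := by
  obtain ⟨s, hs⟩ := exists_intertwining_rightInverse f
    ((Representation.IsIrreducible.surjective_or_eq_zero f).resolve_right hf)
  exact ⟨s, Function.LeftInverse.injective hs⟩

end Averaging

/-! ### Irreducibility and dual representations -/

section Dual

variable {K G V : Type*} [Field K] [Group G] [AddCommGroup V] [Module K V]
  (ρ : Representation K G V)

theorem isIrreducible_of_forall [Nontrivial V]
    (h : ∀ S : Subrepresentation ρ, (∃ v ∈ S.toSubmodule, v ≠ 0) → S.toSubmodule = ⊤) :
    ρ.IsIrreducible where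
  exists_pair_ne := ⟨⊥, ⊤, fun h' => bot_ne_top (α := Submodule K V)
    (congrArg Subrepresentation.toSubmodule h')⟩
  eq_bot_or_eq_top S := by
    by_cases hS : ∃ v ∈ S.toSubmodule, v ≠ 0
    · exact Or.inr (Subrepresentation.toSubmodule_injective (h S hS))
    · left
      push Not at hS
      exact Subrepresentation.toSubmodule_injective ((Submodule.eq_bot_iff _).2 hS)

theorem isIrreducible_nontrivial [h : ρ.IsIrreducible] : Nontrivial V := by
  by_contra hV
  rw [not_nontrivial_iff_subsingleton] at hV
  obtain ⟨S, T, hST⟩ := h.exists_pair_ne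
  exact hST (Subrepresentation.toSubmodule_injective (Subsingleton.elim _ _))

/-- The canonical isomorphism of a finite-dimensional representation with its double dual. -/
def dualDualEquiv [FiniteDimensional K V] : ρ.Equiv ρ.dual.dual :=
  Representation.Equiv.mk (Module.evalEquiv K V) fun g => by
    ext v φ
    change φ (ρ g v) = φ (ρ g⁻¹⁻¹ v)
    rw [inv_inv]

/-- The common zeros of a subrepresentation of the dual form a subrepresentation of `V`, hence `0`
or `V`. In finite dimension a subspace of the dual is recovered from its common zeros. -/
theorem isIrreducible_dual [FiniteDimensional K V] [h : ρ.IsIrreducible] :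
    ρ.dual.IsIrreducible := by
  have := isIrreducible_nontrivial ρ
  refine isIrreducible_of_forall _ fun S hS => ?_
  obtain ⟨φ, hφ, hφ0⟩ := hS
  let T : Subrepresentation ρ :=
    { toSubmodule := S.toSubmodule.dualCoannihilator
      apply_mem_toSubmodule := fun g v hv => by
        rw [Submodule.mem_dualCoannihilator] at hv ⊢
        intro ψ hψ
        have h1 := hv _ (S.apply_mem_toSubmodule g⁻¹ hψ)
        change ψ (ρ g⁻¹⁻¹ v) = 0 at h1
        rwa [inv_inv] at h1 }
  rcases h.eq_bot_or_eq_top T with hT | hT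
  · have h1 : S.toSubmodule.dualCoannihilator = ⊥ := congrArg Subrepresentation.toSubmodule hT
    rw [← Subspace.dualCoannihilator_dualAnnihilator_eq (W := S.toSubmodule), h1,
      Submodule.dualAnnihilator_bot]
  · have h1 : S.toSubmodule.dualCoannihilator = ⊤ := congrArg Subrepresentation.toSubmodule hT
    refine absurd (LinearMap.ext fun v => ?_) hφ0
    have h2 : v ∈ S.toSubmodule.dualCoannihilator := h1 ▸ Submodule.mem_top
    exact (Submodule.mem_dualCoannihilator _).1 h2 φ hφ

end Dual

/-! ## Generators of cyclic modules over finite rings -/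

section CyclicModules

variable {A N : Type*} [Ring A] [AddCommGroup N] [Module A N]

/-- The number of elements of a left ideal which move `z` to a generator `w` of `A z` does not
depend on the generator. -/
theorem card_mem_smul_eq [Fintype A] [DecidableEq N] [DecidableEq (Submodule A A)]
    [∀ I : Submodule A A, DecidablePred (· ∈ I)] {z w : N}
    {c d : A} (hc : c • z = w) (hd : d • w = z) (I : Submodule A A) :
    (Finset.univ.filter fun x : A => x ∈ I ∧ x • z = w).card =
      (Finset.univ.filter fun x : A => x ∈ I ∧ x • z = z).card := by
  by_cases h : ∃ x ∈ I, x • z = z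
  · obtain ⟨x, hx, hxz⟩ := h
    -- Translation by `x - c * x` preserves `I` and changes `y • z` by `z - w`, so it exchanges the
    -- two conditions.
    refine Finset.card_equiv (Equiv.addRight (x - c * x)) fun y => ?_
    simp only [Finset.mem_filter, Finset.mem_univ, true_and, Equiv.coe_addRight]
    have hm : x - c * x ∈ I := sub_mem hx (I.smul_mem c hx)
    rw [add_smul, sub_smul, mul_smul, hxz, hc, I.add_mem_iff_left hm]
    refine and_congr_right fun _ => ?_
    rw [← add_sub_assoc, add_comm, add_sub_assoc, add_eq_left, sub_eq_zero]
  · rw [Finset.filter_eq_empty_iff.2, Finset.filter_eq_empty_iff.2]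
    · rintro y - ⟨hy, hyz⟩
      exact h ⟨y, hy, hyz⟩
    · rintro y - ⟨hy, hyz⟩
      exact h ⟨d * y, I.smul_mem d hy, by rw [mul_smul, hyz, hd]⟩

/-- Two generators of a cyclic module over a finite ring differ by a unit. -/
theorem exists_unit_smul_eq [Finite A] {z w : N} {c d : A} (hc : c • z = w) (hd : d • w = z) :
    ∃ u : Aˣ, u • z = w := by
  classical
  have := Fintype.ofFinite A
  have : Finite (Submodule A A) := Finite.of_injective _ SetLike.coe_injective
  have := Fintype.ofFinite (Submodule A A)
  -- Sort the elements of `I` by the left ideal they generate. The total counts agree by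
  -- `card_mem_smul_eq`, the contributions of smaller ideals agree by induction, and subtraction
  -- leaves the generators of `I`.
  have key : ∀ I : Submodule A A,
      (Finset.univ.filter fun x : A => x • z = w ∧ Submodule.span A {x} = I).card =
        (Finset.univ.filter fun x : A => x • z = z ∧ Submodule.span A {x} = I).card := by
    intro I
    induction I using WellFoundedLT.induction
    rename_i I ih
    have hsum : ∀ w' : N, (Finset.univ.filter fun x : A => x ∈ I ∧ x • z = w').card =
        (Finset.univ.filter fun x : A => x • z = w' ∧ Submodule.span A {x} = I).card +
        ∑ J ∈ Finset.univ.filter (fun J => J < I),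
          (Finset.univ.filter fun x : A => x • z = w' ∧ Submodule.span A {x} = J).card := by
      intro w'
      rw [Finset.card_eq_sum_card_fiberwise (f := fun x => Submodule.span A {x})
        (t := Finset.univ.filter (fun J => J ≤ I))]
      · have hI : Finset.univ.filter (fun J : Submodule A A => J ≤ I) =
            insert I (Finset.univ.filter (fun J => J < I)) := by
          ext J
          simp [le_iff_eq_or_lt]
        rw [hI, Finset.sum_insert (by simp)]
        have hfib : ∀ J ≤ I, ((Finset.univ.filter fun x : A => x ∈ I ∧ x • z = w').filter
            fun x => Submodule.span A {x} = J) =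
            Finset.univ.filter fun x : A => x • z = w' ∧ Submodule.span A {x} = J := by
          intro J hJ
          ext x
          simp only [Finset.mem_filter, Finset.mem_univ, true_and]
          refine ⟨fun h => ⟨h.1.2, h.2⟩, fun h => ⟨⟨?_, h.1⟩, h.2⟩⟩
          exact hJ (h.2 ▸ Submodule.mem_span_singleton_self x)
        rw [hfib I le_rfl]
        congr 1
        refine Finset.sum_congr rfl fun J hJ => ?_
        rw [hfib J (Finset.mem_filter.1 hJ).2.le]
      · intro x hx
        simp only [Finset.coe_filter, Finset.mem_univ, true_and, Set.mem_ofPred_eq] at hx ⊢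
        exact (Submodule.span_singleton_le_iff_mem x I).2 hx.1
    have h1 := card_mem_smul_eq hc hd I
    rw [hsum w, hsum z, Finset.sum_congr rfl fun J hJ => ih J (Finset.mem_filter.1 hJ).2] at h1
    exact Nat.add_right_cancel h1
  -- For the unit ideal, `1` is counted on the side of `z`. So some `x` with `x • z = w` generates
  -- `A`; it has a left inverse and is a unit because `A` is finite.
  have h1 : 0 < (Finset.univ.filter fun x : A => x • z = w ∧ Submodule.span A {x} = ⊤).card := by
    rw [key ⊤]
    refine Finset.card_pos.2 ⟨1, ?_⟩
    simp [Ideal.span_singleton_one]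
  obtain ⟨x, hx⟩ := Finset.card_pos.1 h1
  simp only [Finset.mem_filter, Finset.mem_univ, true_and] at hx
  obtain ⟨y, hy⟩ := Submodule.mem_span_singleton.1 (hx.2 ▸ Submodule.mem_top : (1 : A) ∈ _)
  have hu : IsUnit x := IsUnit.of_mul_eq_one_right y hy
  exact ⟨hu.unit, hx.1⟩

end CyclicModules

/-! ## Equivariant endomorphisms of the permutation module of a finite module -/

section MatrixUnits

variable (K : Type*) {Ω : Type*} [Field K]

/-- The linear map which sends the basis vector `u_x` to `u_y` and kills all other basis vectors,
for `z = (x, y)`. -/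
def matrixUnit (z : Ω × Ω) : (Ω →₀ K) →ₗ[K] (Ω →₀ K) :=
  Finsupp.lsingle z.2 ∘ₗ Finsupp.lapply z.1

theorem matrixUnit_apply (z : Ω × Ω) (u : Ω →₀ K) :
    matrixUnit K z u = Finsupp.single z.2 (u z.1) := rfl

theorem sum_smul_matrixUnit [Fintype Ω] (T : (Ω →₀ K) →ₗ[K] (Ω →₀ K)) :
    ∑ z : Ω × Ω, T (Finsupp.single z.1 1) z.2 • matrixUnit K z = T := by
  classical
  refine Finsupp.lhom_ext fun x c => Finsupp.ext fun y => ?_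
  have hc : T (Finsupp.single x c) = c • T (Finsupp.single x 1) := by
    rw [← map_smul, Finsupp.smul_single_one]
  simp only [LinearMap.sum_apply, LinearMap.smul_apply, matrixUnit_apply, Finsupp.finsetSum_apply,
    Finsupp.smul_apply, smul_eq_mul]
  rw [Fintype.sum_prod_type, Finset.sum_eq_single x, Finset.sum_eq_single y]
  · rw [hc]
    simp [mul_comm]
  · intro y' _ hy'
    simp [hy']
  · simp
  · intro x' _ hx'
    refine Finset.sum_eq_zero fun y' _ => ?_
    simp [hx'.symm]
  · simp

variable {K} {A : Type*} [Ring A] [Finite A] [AddCommGroup Ω] [Module A Ω]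

/-- Triangular inversion along the cyclic submodules `S = A z`. Adding up the unit-orbit sums of all
elements of `S` gives `|Aˣ|` times the operator of `S`. Each generator of `S` contributes the orbit
sum of `z`, because generators differ by units, and the other elements are covered by induction. The
orbit sum of `z` therefore appears with a non-zero multiplicity and can be solved for. -/
theorem sum_units_mem [Fintype Aˣ] [Fintype Ω] [CharZero K]
    [∀ S : Submodule A (Ω × Ω), DecidablePred (· ∈ S)]
    (P : Submodule K ((Ω →₀ K) →ₗ[K] (Ω →₀ K)))
    (hP : ∀ z : Ω × Ω, ∑ w with w ∈ Submodule.span A {z}, matrixUnit K w ∈ P) (z : Ω × Ω) :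
    ∑ u : Aˣ, matrixUnit K (u • z) ∈ P := by
  classical
  obtain ⟨S, hS⟩ : ∃ S, Submodule.span A {z} = S := ⟨_, rfl⟩
  induction S using WellFoundedLT.induction generalizing z
  rename_i S ih
  have hunit : ∀ (u : Aˣ) (w : Ω × Ω), u • w ∈ S ↔ w ∈ S := fun u w =>
    ⟨fun h => by simpa using S.smul_mem (↑u⁻¹ : A) h, fun h => S.smul_mem (u : A) h⟩
  have h1 : ∑ w with w ∈ S, ∑ u : Aˣ, matrixUnit K (u • w) =
      (Fintype.card Aˣ : K) • ∑ w with w ∈ S, matrixUnit K w := by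
    rw [Finset.sum_comm, Nat.cast_smul_eq_nsmul, ← Finset.card_univ, ← Finset.sum_const]
    refine Finset.sum_congr rfl fun u _ => ?_
    refine Finset.sum_equiv (MulAction.toPerm u) (fun w => ?_) fun w _ => rfl
    simp [hunit]
  have h2 : ∀ w, Submodule.span A {w} = S →
      ∑ u : Aˣ, matrixUnit K (u • w) = ∑ u : Aˣ, matrixUnit K (u • z) := by
    intro w hw
    obtain ⟨c, hc⟩ := Submodule.mem_span_singleton.1
      (hS.trans hw.symm ▸ Submodule.mem_span_singleton_self z : z ∈ Submodule.span A {w})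
    obtain ⟨d, hd⟩ := Submodule.mem_span_singleton.1
      (hw.trans hS.symm ▸ Submodule.mem_span_singleton_self w : w ∈ Submodule.span A {z})
    obtain ⟨u₀, rfl⟩ := exists_unit_smul_eq hd hc
    exact Fintype.sum_equiv (Equiv.mulRight u₀) _ _ fun u => by
      rw [Equiv.coe_mulRight, mul_smul]
  have h3 : ∑ w with w ∈ S, ∑ u : Aˣ, matrixUnit K (u • w) =
      ((Finset.univ.filter fun w : Ω × Ω => Submodule.span A {w} = S).card : K) •
        ∑ u : Aˣ, matrixUnit K (u • z) +
      ∑ w with w ∈ S ∧ Submodule.span A {w} ≠ S, ∑ u : Aˣ, matrixUnit K (u • w) := by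
    rw [← Finset.sum_filter_add_sum_filter_not _ (fun w => Submodule.span A {w} = S)]
    simp only [Finset.filter_filter]
    congr 1
    rw [Nat.cast_smul_eq_nsmul, ← Finset.sum_const]
    refine Finset.sum_congr ?_ fun w hw => h2 w (Finset.mem_filter.1 hw).2
    ext w
    simp only [Finset.mem_filter, Finset.mem_univ, true_and, and_iff_right_iff_imp]
    rintro rfl
    exact Submodule.mem_span_singleton_self w
  have h4 : ((Finset.univ.filter fun w : Ω × Ω => Submodule.span A {w} = S).card : K) ≠ 0 := by
    refine Nat.cast_ne_zero.2 (Finset.card_ne_zero.2 ⟨z, ?_⟩)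
    simp [hS]
  have h5 : ((Finset.univ.filter fun w : Ω × Ω => Submodule.span A {w} = S).card : K) •
      ∑ u : Aˣ, matrixUnit K (u • z) ∈ P := by
    have hrest : ∑ w with w ∈ S ∧ Submodule.span A {w} ≠ S,
        ∑ u : Aˣ, matrixUnit K (u • w) ∈ P := by
      refine sum_mem fun w hw => ?_
      obtain ⟨-, hw1, hw2⟩ := Finset.mem_filter.1 hw
      exact ih _ (lt_of_le_of_ne ((Submodule.span_singleton_le_iff_mem w S).2 hw1) hw2) w rfl
    have hadd := P.add_mem (h3 ▸ h1 ▸ P.smul_mem _ (hS ▸ hP z)) (P.smul_mem (-1 : K) hrest)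
    convert hadd using 1
    module
  have h6 := P.smul_mem ((Finset.univ.filter fun w : Ω × Ω => Submodule.span A {w} = S).card : K)⁻¹ h5
  rwa [smul_smul, inv_mul_cancel₀ h4, one_smul] at h6

/-- The operators attached to the cyclic submodules of `Ω × Ω` span the space of all endomorphisms
of `K[Ω]` which commute with the units of `A`. -/
theorem mem_of_sum_span_mem [Fintype Ω] [CharZero K]
    [∀ S : Submodule A (Ω × Ω), DecidablePred (· ∈ S)]
    (P : Submodule K ((Ω →₀ K) →ₗ[K] (Ω →₀ K)))
    (hP : ∀ z : Ω × Ω, ∑ w with w ∈ Submodule.span A {z}, matrixUnit K w ∈ P)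
    (T : (Ω →₀ K) →ₗ[K] (Ω →₀ K))
    (hT : ∀ (u : Aˣ) (x y : Ω),
      T (Finsupp.single (u • x) 1) (u • y) = T (Finsupp.single x 1) y) : T ∈ P := by
  classical
  have := Fintype.ofFinite Aˣ
  -- The matrix coefficients of `T` are constant along unit orbits, so expanding `T` once for each
  -- unit and regrouping produces orbit sums.
  have h1 : (Fintype.card Aˣ : K) • T =
      ∑ z : Ω × Ω, T (Finsupp.single z.1 1) z.2 • ∑ u : Aˣ, matrixUnit K (u • z) := by
    simp only [Finset.smul_sum]
    rw [Finset.sum_comm, Nat.cast_smul_eq_nsmul, ← Finset.card_univ, ← Finset.sum_const]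
    refine Finset.sum_congr rfl fun u _ => ?_
    conv_lhs => rw [← sum_smul_matrixUnit K T]
    refine (Fintype.sum_equiv (MulAction.toPerm u) _ _ fun z => ?_).symm
    rw [MulAction.toPerm_apply, Prod.smul_fst, Prod.smul_snd, hT]
  have h2 : (Fintype.card Aˣ : K) • T ∈ P := by
    rw [h1]
    exact sum_mem fun z _ => P.smul_mem _ (sum_units_mem P hP z)
  have h3 := P.smul_mem (Fintype.card Aˣ : K)⁻¹ h2
  rwa [smul_smul, inv_mul_cancel₀ (Nat.cast_ne_zero.2 Fintype.card_ne_zero), one_smul] at h3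

end MatrixUnits

/-! ## Subfunctors and quotient functors -/

section Subfunctors

open scoped ModuleCat.Algebra

variable {R : Type uR} [Ring R] {n : ℕ} {M : Fin n → Type v} [∀ i, AddCommGroup (M i)]
  [∀ i, Module R (M i)] {k : Type uk} [CommRing k] [Algebra k R]

theorem FunCat.map_add (F : FunCat R M k) {X Y : AddCat R M} (f g : X ⟶ Y) :
    F.obj.map (f + g) = F.obj.map f + F.obj.map g :=
  F.property.1.map_add

theorem FunCat.map_smul (F : FunCat R M k) {X Y : AddCat R M} (c : k) (f : X ⟶ Y) :
    F.obj.map (c • f) = c • F.obj.map f :=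
  F.property.2.map_smul f c

theorem FunCat.map_sum (F : FunCat R M k) {X Y : AddCat R M} {ι : Type*} (s : Finset ι)
    (f : ι → (X ⟶ Y)) : F.obj.map (∑ i ∈ s, f i) = ∑ i ∈ s, F.obj.map (f i) :=
  have := F.property.1
  F.obj.map_sum f s

/-- A subfunctor: a family of submodules which is stable under all morphisms. -/
structure SubFun (F : FunCat R M k) where
  /-- The submodule of the value at an object. -/
  carrier : ∀ X : AddCat R M, Submodule k (F.obj.obj X)
  map_mem : ∀ {X Y : AddCat R M} (f : X ⟶ Y) {x : F.obj.obj X},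
    x ∈ carrier X → F.obj.map f x ∈ carrier Y

namespace SubFun

variable {F : FunCat R M k} (S : SubFun F)

/-- A subfunctor as a functor to `k`-modules. -/
def functor : AddCat R M ⥤ ModuleCat.{v} k where
  obj X := ModuleCat.of k (S.carrier X)
  map f := ModuleCat.ofHom ((F.obj.map f).hom.restrict fun _ hx => S.map_mem f hx)
  map_id X := by
    refine ModuleCat.hom_ext (LinearMap.ext fun x => Subtype.ext ?_)
    change F.obj.map (𝟙 X) x.1 = x.1
    rw [F.obj.map_id]
    rfl
  map_comp f g := by
    refine ModuleCat.hom_ext (LinearMap.ext fun x => Subtype.ext ?_)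
    change F.obj.map (f ≫ g) x.1 = F.obj.map g (F.obj.map f x.1)
    rw [F.obj.map_comp]
    rfl

/-- A subfunctor as an object of `C_{+1}`. -/
def toFunCat : FunCat R M k where
  obj := S.functor
  property := by
    refine ⟨⟨fun {X Y f g} => ?_⟩, ⟨fun {X Y} f c => ?_⟩⟩
    · refine ModuleCat.hom_ext (LinearMap.ext fun x => Subtype.ext ?_)
      exact LinearMap.congr_fun (congrArg ModuleCat.Hom.hom (F.map_add f g)) x.1
    · refine ModuleCat.hom_ext (LinearMap.ext fun x => Subtype.ext ?_)
      exact LinearMap.congr_fun (congrArg ModuleCat.Hom.hom (F.map_smul c f)) x.1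

/-- The inclusion of a subfunctor. -/
def ι : S.toFunCat ⟶ F :=
  ObjectProperty.homMk
    { app := fun X => ModuleCat.ofHom (S.carrier X).subtype
      naturality := fun _ _ _ => rfl }

/-- The quotient by a subfunctor as a functor to `k`-modules. -/
def quotientFunctor : AddCat R M ⥤ ModuleCat.{v} k where
  obj X := ModuleCat.of k (F.obj.obj X ⧸ S.carrier X)
  map {X Y} f := ModuleCat.ofHom
    (Submodule.mapQ (S.carrier X) (S.carrier Y) (F.obj.map f).hom fun _ hx => S.map_mem f hx)
  map_id X := by
    refine ModuleCat.hom_ext (Submodule.linearMap_qext _ (LinearMap.ext fun x => ?_))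
    change Submodule.Quotient.mk (F.obj.map (𝟙 X) x) = Submodule.Quotient.mk x
    rw [F.obj.map_id]
    rfl
  map_comp {X Y Z} f g := by
    refine ModuleCat.hom_ext (Submodule.linearMap_qext _ (LinearMap.ext fun x => ?_))
    change Submodule.Quotient.mk (F.obj.map (f ≫ g) x) =
      Submodule.Quotient.mk (F.obj.map g (F.obj.map f x))
    rw [F.obj.map_comp]
    rfl

/-- The quotient by a subfunctor as an object of `C_{+1}`. -/
def quotient : FunCat R M k where
  obj := S.quotientFunctor
  property := by
    refine ⟨⟨fun {X Y f g} => ?_⟩, ⟨fun {X Y} f c => ?_⟩⟩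
    · refine ModuleCat.hom_ext (Submodule.linearMap_qext _ (LinearMap.ext fun x => ?_))
      exact congrArg (S.carrier Y).mkQ
        (LinearMap.congr_fun (congrArg ModuleCat.Hom.hom (F.map_add f g)) x)
    · refine ModuleCat.hom_ext (Submodule.linearMap_qext _ (LinearMap.ext fun x => ?_))
      exact congrArg (S.carrier Y).mkQ
        (LinearMap.congr_fun (congrArg ModuleCat.Hom.hom (F.map_smul c f)) x)

/-- The projection to the quotient by a subfunctor. -/
def π : F ⟶ S.quotient :=
  ObjectProperty.homMk
    { app := fun X => ModuleCat.ofHom (S.carrier X).mkQ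
      naturality := fun _ _ _ => rfl }

end SubFun

/-- The linear equivalence between the values of isomorphic functors. -/
def appEquiv {F G : FunCat R M k} (e : F ≅ G) (X : AddCat R M) :
    F.obj.obj X ≃ₗ[k] G.obj.obj X :=
  (((ObjectProperty.ι _).mapIso e).app X).toLinearEquiv

/-- A pointwise bijective morphism of functors is an isomorphism. -/
def isoOfBijective {F G : FunCat R M k} (η : F ⟶ G)
    (h : ∀ X, Function.Bijective (η.hom.app X)) : F ≅ G :=
  ObjectProperty.isoMk _ (NatIso.ofComponents
    (fun X => (LinearEquiv.ofBijective (η.hom.app X).hom (h X)).toModuleIso)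
    (fun f => η.hom.naturality f))

variable {F : FunCat R M k}

/-- An abstract isomorphism with `F` would force the value at `X` to have as many elements as
`F(X)`, so finiteness at this one object suffices. -/
theorem SubFun.isProperSubquotient_toFunCat (S : SubFun F) {X : AddCat R M}
    [Finite (F.obj.obj X)] (hX : S.carrier X ≠ ⊤) : IsProperSubquotient S.toFunCat F := by
  refine ⟨⟨S.toFunCat, S.ι, 𝟙 _, fun Y => Subtype.val_injective, fun Y => Function.surjective_id⟩,
    ⟨fun e => hX ?_⟩⟩
  have h := Nat.card_congr (appEquiv e X).toEquiv
  exact SetLike.coe_injective ((Set.eq_univ_iff_ncard _).2 h)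

theorem SubFun.isProperSubquotient_quotient (S : SubFun F) {X : AddCat R M}
    [Finite (F.obj.obj X)] (hX : S.carrier X ≠ ⊥) : IsProperSubquotient S.quotient F := by
  refine ⟨⟨F, 𝟙 _, S.π, fun Y => Function.injective_id,
    fun Y => Submodule.Quotient.mk_surjective _⟩, ⟨fun e => hX ?_⟩⟩
  have h : Nat.card (F.obj.obj X ⧸ S.carrier X) = Nat.card (F.obj.obj X) :=
    Nat.card_congr (appEquiv e X).toEquiv
  have hinj : Function.Injective (S.carrier X).mkQ :=
    ((Nat.bijective_iff_surjective_and_card _).2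
      ⟨Submodule.Quotient.mk_surjective _, h.symm⟩).1
  rw [← Submodule.ker_mkQ (S.carrier X), LinearMap.ker_eq_bot.2 hinj]

theorem IsProperSubquotient.of_iso {F F' G : FunCat R M k} (h : IsProperSubquotient G F)
    (e : F ≅ F') : IsProperSubquotient G F' := by
  obtain ⟨⟨H, i, p, hi, hp⟩, hne⟩ := h
  refine ⟨⟨H, i ≫ e.hom, p, fun X => ?_, hp⟩, ⟨fun e' => hne.false (e' ≪≫ e.symm)⟩⟩
  exact (appEquiv e X).injective.comp (hi X)

/-! ## Evaluation at an element -/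

/-- The map `f ↦ F(f)(x)` for `x ∈ F(X)`. -/
def evalAt (F : FunCat R M k) {X : AddCat R M} (x : F.obj.obj X) (Y : AddCat R M) :
    (X ⟶ Y) →ₗ[k] F.obj.obj Y where
  toFun f := F.obj.map f x
  map_add' f g := by rw [F.map_add]; rfl
  map_smul' c f := by rw [F.map_smul]; rfl

theorem evalAt_apply {X : AddCat R M} (x : F.obj.obj X) {Y : AddCat R M} (f : X ⟶ Y) :
    evalAt F x Y f = F.obj.map f x := rfl

theorem map_evalAt {X : AddCat R M} (x : F.obj.obj X) {Y Z : AddCat R M} (f : X ⟶ Y)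
    (g : Y ⟶ Z) : F.obj.map g (evalAt F x Y f) = evalAt F x Z (f ≫ g) := by
  rw [evalAt_apply, evalAt_apply, F.obj.map_comp]
  rfl

/-- The subfunctor generated by an element. -/
def SubFun.generated {X : AddCat R M} (x : F.obj.obj X) : SubFun F where
  carrier Y := LinearMap.range (evalAt F x Y)
  map_mem g := by
    rintro _ ⟨f, rfl⟩
    exact ⟨f ≫ g, (map_evalAt x f g).symm⟩

/-- The values at `Y` of the subfunctor of `F ⊕ F` generated by `(x, y)`. -/
def genPair {X : AddCat R M} (x y : F.obj.obj X) (Y : AddCat R M) :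
    Submodule k (F.obj.obj Y × F.obj.obj Y) :=
  LinearMap.range ((evalAt F x Y).prod (evalAt F y Y))

theorem map_mem_genPair {X : AddCat R M} {x y : F.obj.obj X} {Y Z : AddCat R M} (g : Y ⟶ Z)
    {z : F.obj.obj Y × F.obj.obj Y} (hz : z ∈ genPair x y Y) :
    (F.obj.map g z.1, F.obj.map g z.2) ∈ genPair x y Z := by
  obtain ⟨f, rfl⟩ := hz
  exact ⟨f ≫ g, Prod.ext (map_evalAt x f g).symm (map_evalAt y f g).symm⟩

/-- The subfunctor of all `x'` such that `(x', 0)` is in the subfunctor of `F ⊕ F` generated by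
`(x, y)`. -/
def SubFun.leftKernel {X : AddCat R M} (x y : F.obj.obj X) : SubFun F where
  carrier Y := (genPair x y Y).comap (LinearMap.inl k _ _)
  map_mem g x' hx' := by
    have h := map_mem_genPair g hx'
    simpa using h

/-- If the subfunctor of `F ⊕ F` generated by `(x, y)` projects onto the first summand and
intersects it trivially, then it is the graph of an automorphism of `F`. -/
theorem exists_aut_of_genPair [∀ Y : AddCat R M, Finite (F.obj.obj Y)] {X : AddCat R M}
    (x y : F.obj.obj X) (h1 : ∀ Y, LinearMap.range (evalAt F x Y) = ⊤)
    (h2 : ∀ Y, (SubFun.leftKernel x y).carrier Y = ⊥) :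
    ∃ α : Aut F, ∀ (Y : AddCat R M) (z : F.obj.obj Y × F.obj.obj Y),
      z ∈ genPair x y Y ↔ α.hom.hom.app Y z.1 = z.2 := by
  let fst (Y : AddCat R M) : genPair x y Y →ₗ[k] F.obj.obj Y :=
    LinearMap.fst k _ _ ∘ₗ (genPair x y Y).subtype
  let snd (Y : AddCat R M) : genPair x y Y →ₗ[k] F.obj.obj Y :=
    LinearMap.snd k _ _ ∘ₗ (genPair x y Y).subtype
  have hfst : ∀ Y, Function.Surjective (fst Y) := fun Y x' => by
    obtain ⟨f, hf⟩ := LinearMap.range_eq_top.1 (h1 Y) x'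
    exact ⟨⟨_, f, rfl⟩, hf⟩
  have hsnd : ∀ Y, Function.Injective (snd Y) := fun Y => by
    rw [← LinearMap.ker_eq_bot, Submodule.eq_bot_iff]
    rintro ⟨⟨x', y'⟩, hz⟩ (rfl : y' = 0)
    have hx' : x' ∈ (SubFun.leftKernel x y).carrier Y := hz
    rw [h2, Submodule.mem_bot] at hx'
    subst hx'
    rfl
  -- One projection is onto and the other is injective; counting in the finite set `F(Y)` makes both
  -- bijective.
  have hcard : ∀ Y, Nat.card (genPair x y Y) = Nat.card (F.obj.obj Y) := fun Y =>
    le_antisymm (Nat.card_le_card_of_injective _ (hsnd Y))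
      (Nat.card_le_card_of_surjective _ (hfst Y))
  have hfst' : ∀ Y, Function.Bijective (fst Y) := fun Y =>
    (Nat.bijective_iff_surjective_and_card _).2 ⟨hfst Y, hcard Y⟩
  have hsnd' : ∀ Y, Function.Bijective (snd Y) := fun Y =>
    (Nat.bijective_iff_injective_and_card _).2 ⟨hsnd Y, hcard Y⟩
  let e (Y : AddCat R M) : F.obj.obj Y ≃ₗ[k] F.obj.obj Y :=
    (LinearEquiv.ofBijective _ (hfst' Y)).symm.trans (LinearEquiv.ofBijective _ (hsnd' Y))
  have he : ∀ Y (z : F.obj.obj Y × F.obj.obj Y), z ∈ genPair x y Y ↔ e Y z.1 = z.2 := by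
    intro Y z
    constructor
    · intro hz
      have : (LinearEquiv.ofBijective _ (hfst' Y)).symm z.1 = ⟨z, hz⟩ :=
        (LinearEquiv.symm_apply_eq _).2 rfl
      simp only [e, LinearEquiv.trans_apply, this]
      rfl
    · intro hz
      obtain ⟨s, hs⟩ := (hfst' Y).2 z.1
      have : (LinearEquiv.ofBijective _ (hfst' Y)).symm z.1 = s :=
        (LinearEquiv.symm_apply_eq _).2 hs.symm
      simp only [e, LinearEquiv.trans_apply, this] at hz
      have : s.1 = z := Prod.ext hs hz
      exact this ▸ s.2
  refine ⟨ObjectProperty.isoMk _ (NatIso.ofComponents (fun Y => (e Y).toModuleIso) ?_), he⟩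
  intro Y Z g
  ext x'
  exact (he Z (_, _)).1 (map_mem_genPair g ((he Y (x', e Y x')).2 rfl))

/-! ## Detection of isomorphisms on `M_1 ⊕ ⋯ ⊕ M_n` -/

/-- Every summand `M_j` of `X` is routed through the single copy of `M_j` in `M_1 ⊕ ⋯ ⊕ M_n`, so `X`
is a retract of a power of that object. -/
theorem exists_sum_comp_eq_id (X : AddCat R M) :
    ∃ (ι : Type) (_ : Fintype ι) (p : ι → (X ⟶ dirSumObj R M fun _ => 1))
      (s : ι → ((dirSumObj R M fun _ => 1) ⟶ X)), ∑ t, p t ≫ s t = 𝟙 X := by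
  obtain ⟨b, ⟨e⟩⟩ := X.property
  refine ⟨Σ j, Fin (b j), inferInstance,
    fun t => ObjectProperty.homMk (ModuleCat.ofHom
      (incl R M (fun _ => 1) t.1 0 ∘ₗ proj R M b t.1 t.2 ∘ₗ e.toLinearMap)),
    fun t => ObjectProperty.homMk (ModuleCat.ofHom
      (e.symm.toLinearMap ∘ₗ incl R M b t.1 t.2 ∘ₗ proj R M (fun _ => 1) t.1 0)), ?_⟩
  refine ObjectProperty.hom_ext _ ?_
  have h1 : (∑ t : Σ j, Fin (b j), (e.symm.toLinearMap ∘ₗ incl R M b t.1 t.2 ∘ₗ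
      proj R M (fun _ => 1) t.1 0) ∘ₗ
      (incl R M (fun _ => 1) t.1 0 ∘ₗ proj R M b t.1 t.2 ∘ₗ e.toLinearMap)) = LinearMap.id := by
    have h2 := sum_incl_comp_proj R M b
    rw [← Fintype.sum_sigma' (f := fun j l => incl R M b j l ∘ₗ proj R M b j l)] at h2
    ext x
    have h3 := congrArg e.symm (LinearMap.congr_fun h2 (e x))
    have h4 : ∀ (j : Fin n) (y : M j),
        proj R M (fun _ => 1) j 0 (incl R M (fun _ => 1) j 0 y) = y := fun j y =>
      LinearMap.congr_fun (proj_comp_incl_same R M (fun _ => 1) j 0) y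
    simp only [LinearMap.sum_apply, LinearMap.comp_apply, map_sum, LinearMap.id_apply,
      LinearEquiv.symm_apply_apply] at h3
    simpa only [LinearMap.sum_apply, LinearMap.comp_apply, h4, LinearEquiv.coe_coe,
      LinearMap.id_apply] using h3
  refine ((isDirSum R M).ι.map_sum _ _).trans (ModuleCat.hom_ext ?_)
  rw [ModuleCat.hom_sum]
  exact h1

/-- By additivity, an element of the value at `X` is recovered from its images under the maps `p t`,
and this recovery is compatible with `η`. -/
theorem bijective_of_bijective_sum {F G : FunCat R M k} (η : F ⟶ G)
    (h : Function.Bijective (η.hom.app (dirSumObj R M fun _ => 1))) (X : AddCat R M) :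
    Function.Bijective (η.hom.app X) := by
  obtain ⟨ι, _, p, s, hps⟩ := exists_sum_comp_eq_id X
  have key : ∀ (H : FunCat R M k) (x : H.obj.obj X),
      ∑ t, H.obj.map (s t) (H.obj.map (p t) x) = x := by
    intro H x
    have h1 := congrArg (fun f : X ⟶ X => evalAt H x X f) hps
    simp only [_root_.map_sum, evalAt_apply, H.obj.map_comp, ModuleCat.comp_apply] at h1
    rw [h1, H.obj.map_id]
    rfl
  constructor
  · refine (injective_iff_map_eq_zero (η.hom.app X).hom).2 fun x hx => ?_
    rw [← key F x]
    refine Finset.sum_eq_zero fun t _ => ?_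
    have h1 : F.obj.map (p t) x = 0 := by
      apply h.1
      rw [map_zero, NatTrans.naturality_apply]
      refine (congrArg _ hx).trans ?_
      rw [map_zero]
    rw [h1, map_zero]
  · intro y
    choose z hz using fun t => h.2 (G.obj.map (p t) y)
    refine ⟨∑ t, F.obj.map (s t) (z t), ?_⟩
    rw [_root_.map_sum]
    conv_rhs => rw [← key G y]
    refine Finset.sum_congr rfl fun t _ => ?_
    rw [NatTrans.naturality_apply, hz]

/-- The value at `M_1 ⊕ ⋯ ⊕ M_n` of a proper subquotient of `F` is smaller than that of `F`. -/
theorem IsProperSubquotient.card_lt {F G : FunCat R M k} (h : IsProperSubquotient G F)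
    [Finite (F.obj.obj (dirSumObj R M fun _ => 1))] :
    Nat.card (G.obj.obj (dirSumObj R M fun _ => 1)) <
      Nat.card (F.obj.obj (dirSumObj R M fun _ => 1)) := by
  obtain ⟨⟨H, i, p, hi, hp⟩, hne⟩ := h
  by_contra! hlt
  have := Finite.of_injective _ (hi (dirSumObj R M fun _ => 1))
  have h1 := Nat.card_le_card_of_injective _ (hi (dirSumObj R M fun _ => 1))
  have h2 := Nat.card_le_card_of_surjective _ (hp (dirSumObj R M fun _ => 1))
  -- Without a strict drop, both legs of the subquotient are bijective at the sum, hence everywhere,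
  -- which makes `G` isomorphic to `F`.
  have hi' := bijective_of_bijective_sum i
    ((Nat.bijective_iff_injective_and_card _).2 ⟨hi _, le_antisymm h1 (hlt.trans h2)⟩)
  have hp' := bijective_of_bijective_sum p
    ((Nat.bijective_iff_surjective_and_card _).2 ⟨hp _, le_antisymm (h1.trans hlt) h2⟩)
  exact hne.false ((isoOfBijective p hp').symm ≪≫ isoOfBijective i hi')

theorem IsProperSubquotient.finite {F G : FunCat R M k} (h : IsProperSubquotient G F)
    [∀ X, Finite (F.obj.obj X)] (X : AddCat R M) : Finite (G.obj.obj X) := by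
  obtain ⟨⟨H, i, p, hi, hp⟩, -⟩ := h
  have := Finite.of_injective _ (hi X)
  exact Finite.of_surjective _ (hp X)

theorem finite_homFunctor [∀ i, Finite (M i)] (a : Fin n → ℕ) (X : AddCat R M) :
    Finite ((homFunctor R M k a).obj.obj X) := by
  obtain ⟨b, ⟨e⟩⟩ := X.property
  have : Finite X.obj := Finite.of_equiv _ e.symm.toEquiv
  have : Finite (DirSum M a →ₗ[R] X.obj) := DFunLike.finite _
  let φ : (dirSumObj R M a ⟶ X) → (DirSum M a →ₗ[R] X.obj) := fun f => f.hom.hom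
  exact Finite.of_injective φ fun f g h => ObjectProperty.hom_ext _ (ModuleCat.hom_ext h)

end Subfunctors

/-! ## Permutation representations of functors -/

section PermutationRepresentations

open scoped ModuleCat.Algebra

variable {R : Type uR} [Ring R] {n : ℕ} {M : Fin n → Type v} [∀ i, AddCommGroup (M i)]
  [∀ i, Module R (M i)] {k : Type uk} [CommRing k] [Algebra k R]
  {a : Fin n → ℕ} {K : Type uK} [Field K] {F G : FunCat R M k}

theorem finite_autGroup [∀ i, Finite (M i)] : Finite (AutGroup R M a) :=
  DFunLike.finite _

/-- An endomorphism of `M_1^{a_1} ⊕ ⋯ ⊕ M_n^{a_n}` as a morphism of `C`. -/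
def endHom (f : Module.End R (DirSum M a)) : dirSumObj R M a ⟶ dirSumObj R M a :=
  ObjectProperty.homMk (ModuleCat.ofHom f)

/-- The value of a functor at `M` as a module over `End_R(M)`. -/
abbrev evalModule (F : FunCat R M k) :
    Module (Module.End R (DirSum M a)) (F.obj.obj (dirSumObj R M a)) :=
  letI : SMul (Module.End R (DirSum M a)) (F.obj.obj (dirSumObj R M a)) :=
    ⟨fun f x => evalAt F x _ (endHom f)⟩
  Module.ofMinimalAxioms
    (fun f x y => map_add (F.obj.map (endHom f)).hom x y)
    (fun f g x => map_add (evalAt F x (dirSumObj R M a)) (endHom f) (endHom g))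
    (fun f g x => (map_evalAt x (endHom g) (endHom f)).symm)
    (fun x => LinearMap.congr_fun (congrArg ModuleCat.Hom.hom (F.obj.map_id _)) x)

theorem map_autHom_mul (g h : AutGroup R M a) (x : F.obj.obj (dirSumObj R M a)) :
    F.obj.map (autHom R M (g * h)) x = F.obj.map (autHom R M g) (F.obj.map (autHom R M h) x) := by
  rw [autHom_mul, F.obj.map_comp]
  rfl

theorem map_autHom_one (x : F.obj.obj (dirSumObj R M a)) :
    F.obj.map (autHom R M (1 : AutGroup R M a)) x = x := by
  rw [autHom_one, F.obj.map_id]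
  rfl

theorem map_autHom_bijective (g : AutGroup R M a) :
    Function.Bijective (F.obj.map (autHom R M g)) :=
  Function.bijective_iff_has_inverse.2 ⟨F.obj.map (autHom R M g⁻¹),
    fun x => by rw [← map_autHom_mul, inv_mul_cancel, map_autHom_one],
    fun x => by rw [← map_autHom_mul, mul_inv_cancel, map_autHom_one]⟩

theorem permRep_single (g : AutGroup R M a) (x : F.obj.obj (dirSumObj R M a)) (c : K) :
    permRep a K F g (Finsupp.single x c) = Finsupp.single (F.obj.map (autHom R M g) x) c :=
  Finsupp.mapDomain_single

theorem permRep_apply_map (g : AutGroup R M a) (u : F.obj.obj (dirSumObj R M a) →₀ K)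
    (x : F.obj.obj (dirSumObj R M a)) :
    permRep a K F g u (F.obj.map (autHom R M g) x) = u x :=
  Finsupp.mapDomain_apply (map_autHom_bijective g).1 u x

variable (a K) in
/-- The intertwining map `KF(M) → KG(M)` induced by a morphism `F → G`. -/
def permMap (η : F ⟶ G) : (permRep a K F).IntertwiningMap (permRep a K G) where
  toLinearMap := Finsupp.lmapDomain K K (η.hom.app (dirSumObj R M a))
  isIntertwining' g := by
    refine LinearMap.ext fun u => ?_
    change Finsupp.mapDomain _ (Finsupp.mapDomain _ u) =
      Finsupp.mapDomain _ (Finsupp.mapDomain _ u)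
    rw [← Finsupp.mapDomain_comp, ← Finsupp.mapDomain_comp]
    congr 1
    funext y
    exact NatTrans.naturality_apply η.hom (autHom R M g) y

variable (a K) in
/-- The intertwining map `KF(M) → KS(M)` given by restriction of coefficients to a subfunctor. -/
def permRestrict (S : SubFun F) :
    (permRep a K F).IntertwiningMap (permRep a K S.toFunCat) where
  toLinearMap := Finsupp.lcomapDomain (fun x : S.carrier (dirSumObj R M a) => x.1)
    Subtype.val_injective
  isIntertwining' g := by
    refine LinearMap.ext fun u => Finsupp.ext fun s => ?_
    obtain ⟨t, rfl⟩ := (map_autHom_bijective (F := S.toFunCat) g).2 s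
    exact (permRep_apply_map g u t.1).trans (permRep_apply_map (F := S.toFunCat) g
      (Finsupp.lcomapDomain (fun x : S.carrier (dirSumObj R M a) => x.1)
        Subtype.val_injective u) t).symm

theorem permMap_apply (η : F ⟶ G) [Fintype (F.obj.obj (dirSumObj R M a))]
    [DecidableEq (G.obj.obj (dirSumObj R M a))]
    (u : F.obj.obj (dirSumObj R M a) →₀ K) (y : G.obj.obj (dirSumObj R M a)) :
    permMap a K η u y = ∑ x with η.hom.app (dirSumObj R M a) x = y, u x := by
  change Finsupp.mapDomain _ u y = _
  rw [Finsupp.mapDomain, Finsupp.sum_fintype _ _ (by simp), Finsupp.finsetSum_apply,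
    Finset.sum_filter]
  exact Finset.sum_congr rfl fun x _ => Finsupp.single_apply

variable {V : Type w} [AddCommGroup V] [Module K V] {ρ : Representation K (AutGroup R M a) V}

theorem IsTypical.eq_zero [ρ.IsIrreducible] (h : IsTypical ρ F) (hG : IsProperSubquotient G F)
    (f : ρ.IntertwiningMap (permRep a K G)) : f = 0 :=
  (Representation.IsIrreducible.injective_or_eq_zero f).resolve_left fun hf => h.2 G hG ⟨f, hf⟩

/-- The coefficients of the image of an `F`-typical representation vanish on proper subfunctors. -/
theorem IsTypical.apply_eq_zero [ρ.IsIrreducible] (h : IsTypical ρ F)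
    (f : ρ.IntertwiningMap (permRep a K F)) (S : SubFun F)
    (hS : IsProperSubquotient S.toFunCat F) (v : V) {x : F.obj.obj (dirSumObj R M a)}
    (hx : x ∈ S.carrier (dirSumObj R M a)) : f v x = 0 := by
  have h1 := h.eq_zero hS ((permRestrict a K S).comp f)
  have h2 := congrArg (fun t : ρ.IntertwiningMap (permRep a K S.toFunCat) => t v) h1
  exact DFunLike.congr_fun h2 (⟨x, hx⟩ : S.carrier (dirSumObj R M a))

/-- The coefficients of the image of an `F`-typical representation sum to zero over the cosets of
non-zero subfunctors. -/
theorem IsTypical.sum_eq_zero [ρ.IsIrreducible] (h : IsTypical ρ F)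
    (f : ρ.IntertwiningMap (permRep a K F)) (S : SubFun F)
    (hS : IsProperSubquotient S.quotient F) [Fintype (F.obj.obj (dirSumObj R M a))]
    [∀ X, DecidablePred (· ∈ S.carrier X)]
    (v : V) (x₀ : F.obj.obj (dirSumObj R M a)) :
    ∑ x with x - x₀ ∈ S.carrier (dirSumObj R M a), f v x = 0 := by
  classical
  have h1 := h.eq_zero hS ((permMap a K S.π).comp f)
  have h2 := congrArg (fun t : ρ.IntertwiningMap (permRep a K S.quotient) => t v) h1
  have h3 := DFunLike.congr_fun h2 (S.π.hom.app (dirSumObj R M a) x₀)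
  refine Eq.trans ?_ ((permMap_apply S.π (f v) _).symm.trans h3)
  refine Finset.sum_congr (Finset.filter_congr fun x _ => ?_) fun _ _ => rfl
  exact (Submodule.Quotient.eq (S.carrier (dirSumObj R M a))).symm

variable (F ρ) in
/-- An element of the multiplicity space as a linear map `V → KF(M)`. -/
def multInclusion : (ρ.IntertwiningMap (permBar a K F).toRepresentation) →ₗ[K]
    (V →ₗ[K] (F.obj.obj (dirSumObj R M a) →₀ K)) where
  toFun f := (permBar a K F).toSubmodule.subtype ∘ₗ f.toLinearMap
  map_add' _ _ := rfl
  map_smul' _ _ := rfl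

theorem multInclusion_injective : Function.Injective (multInclusion F ρ) := fun _ _ h =>
  Representation.IntertwiningMap.ext (LinearMap.ext fun v =>
    Subtype.ext (LinearMap.congr_fun h v))

theorem finite_mult [FiniteDimensional K V] [Finite (F.obj.obj (dirSumObj R M a))] :
    Module.Finite K (ρ.IntertwiningMap (permBar a K F).toRepresentation) :=
  Module.Finite.of_injective (multInclusion F ρ) multInclusion_injective

/-! ### Typical representations and their multiplicity spaces -/

section Finite

variable [∀ i, Finite (M i)] [CharZero K]

/-- A vector which is fixed by the stabilizer of an element of `F(M)` generates a representation
which occurs in `KF(M)`. -/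
theorem occursIn_of_fixed [ρ.IsIrreducible] (x : F.obj.obj (dirSumObj R M a)) {v : V} (hv : v ≠ 0)
    (h : ∀ g : AutGroup R M a, F.obj.map (autHom R M g) x = x → ρ g v = v) : OccursIn ρ F := by
  classical
  have : Finite (AutGroup R M a) := finite_autGroup
  have := Fintype.ofFinite (AutGroup R M a)
  -- Averaging `u_x ↦ v` gives an equivariant map that sends `u_x` to the order of the stabilizer of
  -- `x` times `v`, which is non-zero in characteristic zero.
  let f := sumConj (permRep a K F) ρ ((Finsupp.lapply x).smulRight v)
  refine exists_injective_of_ne_zero f fun hf => ?_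
  have h1 : f (Finsupp.single x 1) = 0 := by rw [hf]; rfl
  have h2 : f (Finsupp.single x 1) =
      ((Finset.univ.filter fun g : AutGroup R M a => F.obj.map (autHom R M g) x = x).card : K)
        • v := by
    rw [sumConj_apply, Nat.cast_smul_eq_nsmul, ← Finset.sum_const, Finset.sum_filter]
    refine Finset.sum_congr rfl fun g _ => ?_
    have h3 : F.obj.map (autHom R M g⁻¹) x = x ↔ F.obj.map (autHom R M g) x = x := by
      constructor <;> intro h'
      · conv_lhs => rw [← h', ← map_autHom_mul, mul_inv_cancel, map_autHom_one]
      · conv_lhs => rw [← h', ← map_autHom_mul, inv_mul_cancel, map_autHom_one]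
    rw [permRep_single]
    change ρ g (Finsupp.single (F.obj.map (autHom R M g⁻¹) x) (1 : K) x • v) = _
    rw [Finsupp.single_apply]
    simp only [h3]
    split_ifs with hg
    · rw [one_smul, h g hg]
    · rw [zero_smul, map_zero]
  rw [h2] at h1
  refine (smul_ne_zero (Nat.cast_ne_zero.2 (Finset.card_ne_zero.2 ⟨1, ?_⟩)) hv) h1
  simp [map_autHom_one]

/-- The image of an `F`-typical representation is contained in `\overline{KF(M)}`. -/
theorem IsTypical.mem_permBar [ρ.IsIrreducible] (h : IsTypical ρ F)
    (f : ρ.IntertwiningMap (permRep a K F)) (v : V) : f v ∈ (permBar a K F).toSubmodule := by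
  have : Finite (AutGroup R M a) := finite_autGroup
  rcases Representation.IsIrreducible.injective_or_eq_zero f with hf | rfl
  · obtain ⟨r, hr⟩ := exists_intertwining_leftInverse f hf
    have hfr : ∀ x ∈ f.range.toSubmodule, f (r x) = x := by
      rintro _ ⟨y, rfl⟩
      exact congrArg f (hr y)
    -- The image of `f` is itself one of the subrepresentations in the supremum: a non-zero map from
    -- `KG(M)` to it would, after `r`, embed `V` in `KG(M)`.
    refine le_sSup (show f.range.toSubmodule ∈ noLowerSet a K F from
      ⟨f.range, fun G hG g => ?_, rfl⟩) ⟨v, rfl⟩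
    let g' : (permRep a K G).IntertwiningMap ρ :=
      { toLinearMap := r.toLinearMap ∘ₗ f.range.toSubmodule.subtype ∘ₗ g.toLinearMap
        isIntertwining' := fun x => by
          refine LinearMap.ext fun u => ?_
          change r (g (permRep a K G x u)).1 = ρ x (r (g u).1)
          rw [g.isIntertwining, ← r.isIntertwining]
          rfl }
    have hg' : g' = 0 := by
      by_contra hne
      obtain ⟨s, hs⟩ := exists_injective_of_ne_zero g' hne
      exact h.2 G hG ⟨s, hs⟩
    refine Representation.IntertwiningMap.ext (LinearMap.ext fun u => Subtype.ext ?_)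
    have h1 : r (g u).1 = 0 :=
      congrArg (fun t : (permRep a K G).IntertwiningMap ρ => t u) hg'
    change (g u).1 = 0
    rw [← hfr _ (g u).2, h1, map_zero]
  · exact zero_mem _

variable [∀ X : AddCat R M, Finite (F.obj.obj X)]

/-- If a space of linear maps contains all translates `α ∘ f` of an `F`-typical representation
under `Aut(F)`, then it contains `T ∘ f` for all equivariant `T`. -/
theorem IsTypical.comp_mem [ρ.IsIrreducible] (h : IsTypical ρ F)
    (f : ρ.IntertwiningMap (permRep a K F))
    (Q : Submodule K (V →ₗ[K] (F.obj.obj (dirSumObj R M a) →₀ K)))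
    (hQ : ∀ α : Aut F, autRep a K F α ∘ₗ f.toLinearMap ∈ Q)
    (T : (permRep a K F).IntertwiningMap (permRep a K F)) :
    T.toLinearMap ∘ₗ f.toLinearMap ∈ Q := by
  classical
  let _ : Module (Module.End R (DirSum M a)) (F.obj.obj (dirSumObj R M a)) := evalModule F
  have := Fintype.ofFinite (F.obj.obj (dirSumObj R M a))
  have : Finite (Module.End R (DirSum M a)) := DFunLike.finite _
  -- The units of `End_R(M)` are `Aut_R(M)`, so it suffices to treat the operators of cyclic
  -- submodules of `F(M) × F(M)`.
  refine mem_of_sum_span_mem (A := Module.End R (DirSum M a))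
    (Q.comap (LinearMap.lcomp K _ f.toLinearMap)) ?_ T.toLinearMap ?_
  · rintro ⟨x, y⟩
    rw [Submodule.mem_comap]
    change (∑ w with w ∈ Submodule.span (Module.End R (DirSum M a)) {(x, y)},
      matrixUnit K w) ∘ₗ f.toLinearMap ∈ Q
    have hspan : ∀ w, w ∈ Submodule.span (Module.End R (DirSum M a)) {(x, y)} ↔
        w ∈ genPair x y (dirSumObj R M a) := by
      intro w
      rw [Submodule.mem_span_singleton]
      exact ⟨fun ⟨c, hc⟩ => ⟨endHom c, hc⟩, fun ⟨c, hc⟩ => ⟨c.hom.hom, hc⟩⟩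
    have happ : ∀ v y', ((∑ w with w ∈ Submodule.span (Module.End R (DirSum M a)) {(x, y)},
        matrixUnit K w) ∘ₗ f.toLinearMap) v y' =
        ∑ x' with (x', y') ∈ genPair x y (dirSumObj R M a), f v x' := by
      intro v y'
      simp only [LinearMap.comp_apply, LinearMap.sum_apply, matrixUnit_apply,
        Finsupp.finsetSum_apply, hspan]
      rw [Finset.sum_filter, Fintype.sum_prod_type, Finset.sum_filter]
      refine Finset.sum_congr rfl fun x' _ => ?_
      rw [Finset.sum_eq_single y' (fun y'' _ hy'' => by simp [hy'']) (by simp)]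
      simp
    by_cases h1 : ∀ Y, LinearMap.range (evalAt F x Y) = ⊤
    · by_cases h2 : ∀ Y, (SubFun.leftKernel x y).carrier Y = ⊥
      · obtain ⟨α, hα⟩ := exists_aut_of_genPair x y h1 h2
        convert hQ α using 1
        refine LinearMap.ext fun v => Finsupp.ext fun y' => ?_
        rw [happ]
        exact (Finset.sum_congr (Finset.filter_congr fun x' _ => hα _ _) fun _ _ => rfl).trans
          (permMap_apply α.hom (f v) y').symm
      -- A non-zero left kernel: the elements related to a fixed `y'` form a coset of its value at
      -- `M` or the empty set, and the coefficients of `f v` sum to zero over both.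
      · push Not at h2
        obtain ⟨Y, hY⟩ := h2
        have hS := (SubFun.leftKernel x y).isProperSubquotient_quotient hY
        convert Q.zero_mem
        refine LinearMap.ext fun v => Finsupp.ext fun y' => ?_
        rw [happ]
        by_cases h3 : ∃ x₀, (x₀, y') ∈ genPair x y (dirSumObj R M a)
        · obtain ⟨x₀, hx₀⟩ := h3
          refine Eq.trans ?_ (h.sum_eq_zero f _ hS v x₀)
          refine Finset.sum_congr (Finset.filter_congr fun x' _ => ?_) fun _ _ => rfl
          have h4 : ((x' - x₀, 0) : F.obj.obj (dirSumObj R M a) × F.obj.obj (dirSumObj R M a)) =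
              (x', y') - (x₀, y') := by
            rw [Prod.mk_sub_mk, sub_self]
          change _ ↔ (x' - x₀, 0) ∈ genPair x y (dirSumObj R M a)
          rw [h4, Submodule.sub_mem_iff_left _ hx₀]
        · push Not at h3
          exact Finset.sum_eq_zero fun x' hx' => absurd (Finset.mem_filter.1 hx').2 (h3 x')
    -- Here `x` generates a proper subfunctor. All first coordinates of the relation lie in it, and
    -- there the coefficients of `f v` vanish.
    · push Not at h1
      obtain ⟨Y, hY⟩ := h1
      have hS := (SubFun.generated x).isProperSubquotient_toFunCat hY
      convert Q.zero_mem
      refine LinearMap.ext fun v => Finsupp.ext fun y' => ?_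
      rw [happ]
      refine Finset.sum_eq_zero fun x' hx' => h.apply_eq_zero f _ hS v ?_
      obtain ⟨c, hc⟩ := (Finset.mem_filter.1 hx').2
      exact ⟨c, congrArg Prod.fst hc⟩
  · intro u x y
    let g : AutGroup R M a := LinearMap.GeneralLinearGroup.generalLinearEquiv R _ u
    have h1 : T (permRep a K F g (Finsupp.single x 1)) = permRep a K F g (T (Finsupp.single x 1)) :=
      Representation.IntertwiningMap.isIntertwining _ _ T g _
    rw [permRep_single] at h1
    exact (DFunLike.congr_fun h1 _).trans (permRep_apply_map g _ y)

/-- The multiplicity space of an `F`-typical representation is an irreducible representation of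
`Aut(F)`. -/
theorem IsTypical.isIrreducible_multRep [ρ.IsIrreducible] (h : IsTypical ρ F) :
    letI : AddCommGroup (ρ.IntertwiningMap (permBar a K F).toRepresentation) :=
      Module.addCommMonoidToAddCommGroup K
    (multRep ρ F).IsIrreducible := by
  let _ : AddCommGroup (ρ.IntertwiningMap (permBar a K F).toRepresentation) :=
    Module.addCommMonoidToAddCommGroup K
  have : Finite (AutGroup R M a) := finite_autGroup
  have hV := isIrreducible_nontrivial ρ
  let lift (f : ρ.IntertwiningMap (permRep a K F)) :
      ρ.IntertwiningMap (permBar a K F).toRepresentation :=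
    { toLinearMap := f.toLinearMap.codRestrict _ (h.mem_permBar f)
      isIntertwining' := fun g => LinearMap.ext fun v => Subtype.ext
        (Representation.IntertwiningMap.isIntertwining _ _ f g v) }
  let incl := multInclusion F ρ
  let forget (f : ρ.IntertwiningMap (permBar a K F).toRepresentation) :
      ρ.IntertwiningMap (permRep a K F) :=
    { toLinearMap := incl f
      isIntertwining' := fun g => LinearMap.ext fun v =>
        congrArg Subtype.val (Representation.IntertwiningMap.isIntertwining _ _ f g v) }
  have hincl : Function.Injective incl := multInclusion_injective
  obtain ⟨f₀, hf₀⟩ := h.1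
  have : Nontrivial (ρ.IntertwiningMap (permBar a K F).toRepresentation) := by
    refine ⟨lift f₀, 0, fun h0 => ?_⟩
    obtain ⟨v, hv⟩ := exists_ne (0 : V)
    refine hv (hf₀ ?_)
    rw [map_zero]
    exact congrArg (fun t : ρ.IntertwiningMap (permBar a K F).toRepresentation => (t v).1) h0
  refine isIrreducible_of_forall _ fun S hS => ?_
  obtain ⟨f, hfS, hf⟩ := hS
  refine eq_top_iff.2 fun f' _ => ?_
  have hfinj : Function.Injective (forget f) := by
    refine (Representation.IsIrreducible.injective_or_eq_zero (forget f)).resolve_right fun h0 => ?_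
    exact hf (hincl (congrArg Representation.IntertwiningMap.toLinearMap h0))
  obtain ⟨r, hr⟩ := exists_intertwining_leftInverse (forget f) hfinj
  -- The equivariant endomorphism `f' ∘ r` turns `f` into `f'`, and the translates of `f` under
  -- `Aut(F)` stay in `S`.
  have h1 := h.comp_mem (forget f) (S.toSubmodule.map incl)
    (fun α => ⟨multRep ρ F α f, S.apply_mem_toSubmodule α hfS, rfl⟩) ((forget f').comp r)
  obtain ⟨f'', hf''S, hf''⟩ := h1
  have h2 : f'' = f' := hincl (hf''.trans (LinearMap.ext fun v => congrArg (forget f') (hr v)))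
  exact h2 ▸ hf''S

/-- Every representation which is typical for a functor with finite values admits a functor
morphing to it. -/
theorem IsTypical.exists_functorMorphs [ρ.IsIrreducible] (h : IsTypical ρ F) :
    ∃ (U : Type (max v w uK)) (_ : AddCommGroup U) (_ : Module K U)
      (σ : Representation K (Aut F) U), FunctorMorphs ρ F σ := by
  obtain ⟨f, hf⟩ := h.1
  have : FiniteDimensional K V := FiniteDimensional.of_injective f.toLinearMap hf
  let _ : AddCommGroup (ρ.IntertwiningMap (permBar a K F).toRepresentation) :=
    Module.addCommMonoidToAddCommGroup K
  have : (multRep ρ F).IsIrreducible := IsTypical.isIrreducible_multRep h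
  have : FiniteDimensional K (ρ.IntertwiningMap (permBar a K F).toRepresentation) :=
    finite_mult
  exact ⟨Module.Dual K (ρ.IntertwiningMap (permBar a K F).toRepresentation), inferInstance,
    inferInstance, (multRep ρ F).dual, h, isIrreducible_dual _, ⟨dualDualEquiv _⟩⟩

end Finite

variable (k) in
/-- Every irreducible representation of `Aut_R(M)` is typical for some functor with finite
values. -/
theorem exists_isTypical [∀ i, Finite (M i)] [CharZero K] [ρ.IsIrreducible] :
    ∃ F : FunCat R M k, (∀ X : AddCat R M, Finite (F.obj.obj X)) ∧ IsTypical ρ F := by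
  have hV := isIrreducible_nontrivial ρ
  obtain ⟨v, hv⟩ := exists_ne (0 : V)
  have h0 : OccursIn ρ (homFunctor R M k a) := by
    refine occursIn_of_fixed (𝟙 (dirSumObj R M a) : dirSumObj R M a ⟶ dirSumObj R M a) hv
      fun g hg => ?_
    have h1 : autHom R M g = 𝟙 _ := (Category.id_comp _).symm.trans hg
    have h2 : g = 1 := LinearEquiv.toLinearMap_injective
      (congrArg (fun f : dirSumObj R M a ⟶ dirSumObj R M a => f.hom.hom) h1)
    rw [h2, map_one, Module.End.one_apply]
  -- Finiteness of values passes to proper subquotients, so a minimizer within this set has no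
  -- competitor outside it.
  let s : Set (FunCat R M k) := {F | (∀ X : AddCat R M, Finite (F.obj.obj X)) ∧ OccursIn ρ F}
  have hs : s.Nonempty := ⟨_, finite_homFunctor a, h0⟩
  let size : FunCat R M k → ℕ := fun F => Nat.card (F.obj.obj (dirSumObj R M fun _ => 1))
  refine ⟨Function.argminOn size s hs, (Function.argminOn_mem size s hs).1,
    (Function.argminOn_mem size s hs).2, fun G hG hGρ => ?_⟩
  have := (Function.argminOn_mem size s hs).1
  exact Function.not_lt_argminOn size s (show G ∈ s from ⟨hG.finite, hGρ⟩) hG.card_lt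

end PermutationRepresentations

/-! ## Linear algebra over commutative rings which are fields -/

section IsField

/-- Stated with `IsField` because the residue algebra carries a commutative ring instance and is a
field only by `residueAlg_isField`. -/
theorem exists_vecMul_eq_zero {E m l : Type*} [CommRing E] (hE : IsField E) [Fintype m]
    [Fintype l] (A : Matrix m l E) (hA : A.rank < Fintype.card m) :
    ∃ c : m → E, c ≠ 0 ∧ Matrix.vecMul c A = 0 := by
  let _ := hE.toField
  by_contra! h
  refine hA.ne (LinearIndependent.rank_matrix ?_)
  rw [← Matrix.vecMul_injective_iff]
  refine (injective_iff_map_eq_zero A.vecMulLinear).2 fun c hc => ?_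
  by_contra hc0
  exact h c hc0 hc

theorem exists_trace_mul_ne_zero {E : Type*} [CommRing E] [Finite E] (hE : IsField E)
    [Algebra (ZMod (ringChar E)) E] {x : E} (hx : x ≠ 0) :
    ∃ y, Algebra.trace (ZMod (ringChar E)) E (y * x) ≠ 0 := by
  let _ := hE.toField
  obtain ⟨y, hy⟩ := FiniteField.trace_to_zmod_nondegenerate E hx
  exact ⟨y, mul_comm x y ▸ hy⟩

theorem ringChar_prime_of_isField {E : Type*} [CommRing E] [Finite E] (hE : IsField E) :
    (ringChar E).Prime := by
  let _ := hE.toField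
  exact CharP.char_is_prime E _

theorem nonempty_basis_of_isField {E X : Type*} [Ring E] (hE : IsField E) [AddCommGroup X]
    [Module E X] [Finite X] : Nonempty (Module.Basis (Fin (Module.finrank E X)) E X) := by
  let _ := hE.toField
  have : Module.Finite E X := Module.Finite.of_finite
  exact ⟨Module.finBasis E X⟩

end IsField

/-! ## The characters of the subgroups `N_i` -/

section Characters

variable {R : Type uR} [Ring R] {K : Type uK} [Field K]

section Psi

variable {N : Type*} [AddCommGroup N] [Module R N] [Finite N] [IsIndecomposable R N]

theorem psi_zero (ζ : K) : psi ζ (0 : ResidueAlg R N) = 1 := by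
  simp [psi]

theorem psi_add {ζ : K} (hζ : IsPrimitiveRoot ζ (ringChar (ResidueAlg R N)))
    (x y : ResidueAlg R N) : psi ζ (x + y) = psi ζ x * psi ζ y := by
  have : NeZero (ringChar (ResidueAlg R N)) :=
    ⟨(ringChar_prime_of_isField (residueAlg_isField (R := R) (N := N))).ne_zero⟩
  rw [psi, psi, psi, map_add, ZMod.val_add, ← pow_add, ← pow_eq_pow_mod _ hζ.pow_eq_one]

/-- The trace form of a finite field over its prime field is non-degenerate, and a non-zero residue
has a representative strictly between `0` and `p`, so the power of `ζ` is not `1`. -/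
theorem exists_psi_mul_ne_one {ζ : K} (hζ : IsPrimitiveRoot ζ (ringChar (ResidueAlg R N)))
    {x : ResidueAlg R N} (hx : x ≠ 0) : ∃ y, psi ζ (y * x) ≠ 1 := by
  have : NeZero (ringChar (ResidueAlg R N)) :=
    ⟨(ringChar_prime_of_isField (residueAlg_isField (R := R) (N := N))).ne_zero⟩
  let _ : Algebra (ZMod (ringChar (ResidueAlg R N))) (ResidueAlg R N) := ZMod.algebra _ _
  obtain ⟨y, hy⟩ := exists_trace_mul_ne_zero residueAlg_isField hx
  refine ⟨y, fun h => hy ?_⟩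
  rw [← ZMod.val_eq_zero]
  exact Nat.eq_zero_of_dvd_of_lt ((hζ.pow_eq_one_iff_dvd _).1 h) (ZMod.val_lt _)

end Psi

variable {n : ℕ} {M : Fin n → Type v} [∀ i, AddCommGroup (M i)]
  [∀ i, Module R (M i)] {a : Fin n → ℕ} {i : Fin n}

theorem card_col : Fintype.card (Col R M a i) = lmTotalDim R M a i := by
  simp [lmTotalDim, Fintype.card_sigma]

theorem sum_source_eq_lmTotalDim (i : Fin n) :
    ∑ e : LMArrow R M with e.target = i, a e.source = lmTotalDim R M a i := by
  rw [Finset.sum_filter, Fintype.sum_sigma, Fintype.sum_prod_type, lmTotalDim]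
  refine Finset.sum_congr rfl fun j _ => ?_
  rw [Finset.sum_eq_single i]
  · simp [LMArrow.target, LMArrow.source, mul_comm]
  · intro i' _ hi'
    simp [LMArrow.target, hi']
  · simp

theorem exists_comp_incl_eq (f : ∀ j, Fin (a j) → (M j →ₗ[R] M i)) :
    ∃ F : DirSum M a →ₗ[R] M i, ∀ j l, F ∘ₗ incl R M a j l = f j l := by
  refine ⟨∑ j, ∑ l, f j l ∘ₗ proj R M a j l, fun j l => LinearMap.ext fun x => ?_⟩
  have hp : ∀ j' l', (⟨j, l⟩ : Σ j, Fin (a j)) ≠ ⟨j', l'⟩ →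
      proj R M a j' l' (incl R M a j l x) = 0 := fun j' l' h =>
    LinearMap.congr_fun (proj_comp_incl_of_ne R M a j' l' j l h.symm) x
  simp only [LinearMap.comp_apply, LinearMap.sum_apply]
  rw [Finset.sum_eq_single j, Finset.sum_eq_single l]
  · exact congrArg (f j l) (LinearMap.congr_fun (proj_comp_incl_same R M a j l) x)
  · intro l' _ hl'
    rw [hp j l' (fun h => hl' (by cases h; rfl)), map_zero]
  · simp
  · intro j' _ hj'
    refine Finset.sum_eq_zero fun l' _ => ?_
    rw [hp j' l' (fun h => hj' (by cases h; rfl)), map_zero]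
  · simp

variable [∀ i, Finite (M i)] [∀ i, IsIndecomposable R (M i)]

theorem chi_zero_right (ζ : K) (A : Matrix (Col R M a i) (Fin (a i)) (ResidueAlg R (M i))) :
    chi ζ A 0 = 1 := by
  rw [chi, Matrix.mul_zero, Matrix.trace_zero, psi_zero]

theorem chi_add_right {ζ : K} (hζ : IsPrimitiveRoot ζ (ringChar (ResidueAlg R (M i))))
    (A : Matrix (Col R M a i) (Fin (a i)) (ResidueAlg R (M i)))
    (B B' : Matrix (Fin (a i)) (Col R M a i) (ResidueAlg R (M i))) :
    chi ζ A (B + B') = chi ζ A B * chi ζ A B' := by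
  rw [chi, Matrix.mul_add, Matrix.trace_add, psi_add hζ]
  rfl

theorem chi_add_left {ζ : K} (hζ : IsPrimitiveRoot ζ (ringChar (ResidueAlg R (M i))))
    (A A' : Matrix (Col R M a i) (Fin (a i)) (ResidueAlg R (M i)))
    (B : Matrix (Fin (a i)) (Col R M a i) (ResidueAlg R (M i))) :
    chi ζ (A + A') B = chi ζ A B * chi ζ A' B := by
  rw [chi, Matrix.add_mul, Matrix.trace_add, psi_add hζ]
  rfl

theorem exists_chi_ne_one {ζ : K} (hζ : IsPrimitiveRoot ζ (ringChar (ResidueAlg R (M i))))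
    {B : Matrix (Fin (a i)) (Col R M a i) (ResidueAlg R (M i))} (hB : B ≠ 0) :
    ∃ A, chi ζ A B ≠ 1 := by
  classical
  obtain ⟨r, c, hrc⟩ : ∃ r c, B r c ≠ 0 := by
    by_contra! h
    exact hB (Matrix.ext h)
  obtain ⟨y, hy⟩ := exists_psi_mul_ne_one hζ hrc
  refine ⟨Matrix.single c r y, ?_⟩
  rwa [chi, Matrix.trace_single_mul]

/-- Translating the summation variable by an `A₀` with `chi ζ A₀ B ≠ 1` multiplies the sum by that
value. -/
theorem sum_chi_eq_zero {ζ : K} (hζ : IsPrimitiveRoot ζ (ringChar (ResidueAlg R (M i))))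
    [Fintype (Matrix (Col R M a i) (Fin (a i)) (ResidueAlg R (M i)))]
    {B : Matrix (Fin (a i)) (Col R M a i) (ResidueAlg R (M i))} (hB : B ≠ 0) :
    ∑ A, chi ζ A B = 0 := by
  obtain ⟨A₀, hA₀⟩ := exists_chi_ne_one hζ hB
  have h : ∑ A, chi ζ A B = chi ζ A₀ B * ∑ A, chi ζ A B := by
    rw [Finset.mul_sum]
    exact (Fintype.sum_equiv (Equiv.addLeft A₀) _ _ fun A => (chi_add_left hζ A₀ A B).symm).symm
  have h1 : (1 - chi ζ A₀ B) * ∑ A, chi ζ A B = 0 := by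
    rw [sub_mul, one_mul, ← h, sub_self]
  exact (mul_eq_zero.1 h1).resolve_left (sub_ne_zero.2 hA₀.symm)

variable {V : Type w} [AddCommGroup V] [Module K V] (ρ : Representation K (AutGroup R M a) V)
  (hM : ∀ i j, i ≠ j → IsEmpty (M i ≃ₗ[R] M j))

/-- Some character `χ_A ∘ θ` occurs in the restriction of a non-zero representation to `N_i`. -/
theorem exists_chi_eigenvector [CharZero K] [Nontrivial V] (b : LMBasis R M i) {ζ : K}
    (hζ : IsPrimitiveRoot ζ (ringChar (ResidueAlg R (M i)))) :
    ∃ A : Matrix (Col R M a i) (Fin (a i)) (ResidueAlg R (M i)), ∃ v : V, v ≠ 0 ∧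
      ∀ u : subgroupN R M a i, ρ u v = chi ζ A (theta hM b u).toAdd • v := by
  classical
  have : Finite (Matrix (Fin (a i)) (Col R M a i) (ResidueAlg R (M i))) :=
    inferInstanceAs (Finite (_ → _ → _))
  have : Finite (Matrix (Col R M a i) (Fin (a i)) (ResidueAlg R (M i))) :=
    inferInstanceAs (Finite (_ → _ → _))
  have := Fintype.ofFinite (Matrix (Fin (a i)) (Col R M a i) (ResidueAlg R (M i)))
  have := Fintype.ofFinite (Matrix (Col R M a i) (Fin (a i)) (ResidueAlg R (M i)))
  obtain ⟨v, hv⟩ := exists_ne (0 : V)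
  let τ (B : Matrix (Fin (a i)) (Col R M a i) (ResidueAlg R (M i))) : V →ₗ[K] V :=
    ρ ((theta hM b).symm (Multiplicative.ofAdd B) : AutGroup R M a)
  have hτ0 : τ 0 = 1 := by
    simp only [τ, ofAdd_zero, map_one, Subgroup.coe_one]
  have hτadd : ∀ B B', τ (B + B') = τ B * τ B' := fun B B' => by
    simp only [τ, ofAdd_add, map_mul, Subgroup.coe_mul]
  -- The unnormalized projection of `v` to the eigenspace of `χ_A`. By orthogonality these
  -- projections add up to a non-zero multiple of `v`, so one of them is non-zero.
  let e (A : Matrix (Col R M a i) (Fin (a i)) (ResidueAlg R (M i))) : V :=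
    ∑ B, chi ζ A (-B) • τ B v
  have hsum : ∑ A, e A =
      (Fintype.card (Matrix (Col R M a i) (Fin (a i)) (ResidueAlg R (M i))) : K) • v := by
    simp only [e]
    rw [Finset.sum_comm, Finset.sum_eq_single 0]
    · simp only [neg_zero, chi_zero_right, one_smul, hτ0, Module.End.one_apply]
      rw [Finset.sum_const, Finset.card_univ, Nat.cast_smul_eq_nsmul]
    · intro B _ hB
      rw [← Finset.sum_smul, sum_chi_eq_zero hζ (neg_ne_zero.2 hB), zero_smul]
    · simp
  obtain ⟨A, hA⟩ : ∃ A, e A ≠ 0 := by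
    by_contra! h
    rw [Finset.sum_eq_zero fun A _ => h A] at hsum
    exact smul_ne_zero (Nat.cast_ne_zero.2 Fintype.card_ne_zero) hv hsum.symm
  refine ⟨A, e A, hA, fun u => ?_⟩
  obtain ⟨B₀, rfl⟩ : ∃ B₀, (theta hM b).symm (Multiplicative.ofAdd B₀) = u :=
    ⟨(theta hM b u).toAdd, by simp⟩
  rw [MulEquiv.apply_symm_apply, toAdd_ofAdd]
  change τ B₀ (e A) = _
  simp only [e, map_sum, map_smul, Finset.smul_sum, smul_smul]
  refine Fintype.sum_equiv (Equiv.addLeft B₀) _ _ fun B => ?_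
  rw [Equiv.coe_addLeft, hτadd, Module.End.mul_apply, ← chi_add_right hζ]
  rw [neg_add_rev, add_comm (-B), add_neg_cancel_left]

/-- If `D_i > a_i`, then every representation is degenerate. -/
theorem isDegenerate_of_lt [CharZero K] [IsAlgClosed K] [Nontrivial V]
    (h : a i < lmTotalDim R M a i) : IsDegenerate hM ρ := by
  have hE := residueAlg_isField (R := R) (N := M i)
  have : NeZero ((ringChar (ResidueAlg R (M i)) : ℕ) : K) :=
    ⟨Nat.cast_ne_zero.2 (ringChar_prime_of_isField hE).ne_zero⟩
  obtain ⟨ζ, hζ⟩ := HasEnoughRootsOfUnity.exists_primitiveRoot K (ringChar (ResidueAlg R (M i)))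
  have hb : ∀ j, Nonempty (Module.Basis (Fin (lmDim R M j i)) (ResidueAlg R (M i))
      (LM R M j i)) := fun j => by
    have : Finite (M j →ₗ[R] M i) := DFunLike.finite _
    exact nonempty_basis_of_isField hE
  let b : LMBasis R M i := fun j => (hb j).some
  obtain ⟨A, v, hv, hA⟩ := exists_chi_eigenvector ρ hM b hζ
  refine ⟨i, b, ζ, A, hζ, ⟨v, hv, hA⟩, lt_of_le_of_lt ?_ h⟩
  exact (Matrix.rank_le_card_width A).trans_eq (Fintype.card_fin _)

variable {ρ hM} in
/-- A degenerate representation contains a non-zero vector which is fixed by all automorphisms of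
the form `1 + h f`, for some non-zero left maximal `f : M → M_i`. -/
theorem IsDegenerate.exists_fixed (hρ : IsDegenerate hM ρ) :
    ∃ (i : Fin n) (f : DirSum M a →ₗ[R] M i) (v : V), f ≠ 0 ∧ v ≠ 0 ∧
      ∀ (u : AutGroup R M a) (h : M i →ₗ[R] DirSum M a), toEnd R M a u - 1 = h ∘ₗ f →
        ρ u v = v := by
  obtain ⟨i, b, ζ, A, hζ, ⟨v, hv, hA⟩, hrank⟩ := hρ
  obtain ⟨c, hc0, hc⟩ := exists_vecMul_eq_zero (residueAlg_isField (R := R) (N := M i)) A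
    ((card_col (R := R) (M := M) (a := a) (i := i)).symm ▸ hrank)
  -- The left null vector `c` of `A` is read as the coordinates of a morphism `f : M → M_i` in the
  -- chosen bases.
  let p (j : Fin n) (l : Fin (a j)) : LM R M j i := ∑ k, c ⟨j, l, k⟩ • b j k
  obtain ⟨f, hf⟩ :=
    exists_comp_incl_eq (R := R) (M := M) (i := i) fun j l => (p j l : M j →ₗ[R] M i)
  refine ⟨i, f, v, ?_, hv, fun u h hu => ?_⟩
  · rintro rfl
    refine hc0 (funext fun ⟨j, l, k⟩ => ?_)
    have h1 : p j l = 0 := Subtype.ext (hf j l).symm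
    exact Fintype.linearIndependent_iff.1 (b j).linearIndependent _ h1 k
  · have hfLM : f ∈ LMTotal R M a i := mem_LMTotal.2 fun j l => by
      rw [hf]
      exact (p j l).2
    have huN : u ∈ subgroupN R M a i :=
      mem_subgroupN.2 (hu ▸ AddSubgroup.subset_closure ⟨f, hfLM, h, rfl⟩)
    have h1 := hA ⟨u, huN⟩
    let B : Matrix (Fin (a i)) (Col R M a i) (ResidueAlg R (M i)) :=
      (theta hM b ⟨u, huN⟩).toAdd
    have hB : matrixToEnd b B = h ∘ₗ f :=
      (congrArg Subtype.val ((matrixEquiv hM b).apply_symm_apply (subOne ⟨u, huN⟩))).trans hu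
    -- The matrix of `h ∘ f` is a column, the residues of the components of `h`, times the row `c`.
    -- Since `c A = 0`, the trace of `B A` vanishes.
    have hentry : ∀ r (q : Col R M a i),
        B r q = toResidue R (M i) (proj R M a i r ∘ₗ h) * c q := by
      rintro r ⟨j, l, k⟩
      have h2 := matrixToEnd_entry b B r j l
      rw [hB, LinearMap.comp_assoc, hf] at h2
      have h3 : ∑ k, B r ⟨j, l, k⟩ • b j k =
          ∑ k, (toResidue R (M i) (proj R M a i r ∘ₗ h) * c ⟨j, l, k⟩) • b j k := by
        refine (Subtype.ext h2.symm : _ = toResidue R (M i) (proj R M a i r ∘ₗ h) • p j l).trans ?_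
        simp only [p, Finset.smul_sum, mul_smul]
      have h4 := congrArg (fun x => ((b j).repr x : _ → ResidueAlg R (M i))) h3
      simp only [Module.Basis.repr_sum_self] at h4
      exact congrFun h4 k
    have htr : (A * B).trace = 0 := by
      rw [Matrix.trace_mul_comm, Matrix.trace]
      refine Finset.sum_eq_zero fun r _ => ?_
      rw [Matrix.diag_apply, Matrix.mul_apply]
      simp only [hentry, mul_assoc]
      rw [← Finset.mul_sum]
      have h2 : ∑ q, c q * A q r = 0 := congrFun hc r
      rw [h2, mul_zero]
    have h2 : chi ζ A B = 1 := by rw [chi, htr, psi_zero]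
    exact h1.trans ((congrArg (· • v) h2).trans (one_smul K v))

end Characters

/-! ## Degenerate representations -/

section Degenerate

open scoped ModuleCat.Algebra

variable {R : Type uR} [Ring R] {n : ℕ} {M : Fin n → Type v} [∀ i, AddCommGroup (M i)]
  [∀ i, Module R (M i)] (k : Type uk) [CommRing k] [Algebra k R]
  {a : Fin n → ℕ} {K : Type uK} [Field K]

/-- The subfunctor of `Hom_C(M, -)` of all morphisms which factor through `f : M → M_i`. -/
def SubFun.factorThrough {N : Type v} [AddCommGroup N] [Module R N] (f : DirSum M a →ₗ[R] N) :
    SubFun (homFunctor R M k a) where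
  carrier X := LinearMap.range
    ({ toFun := fun h => ObjectProperty.homMk (ModuleCat.ofHom f ≫ h)
       map_add' := fun h h' => ObjectProperty.hom_ext _ (Preadditive.comp_add _ _ _ _ _ _)
       map_smul' := fun c h => ObjectProperty.hom_ext _ (Linear.comp_smul _ _ _ _ _ _) } :
      (ModuleCat.of R N ⟶ X.obj) →ₗ[k] (dirSumObj R M a ⟶ X))
  map_mem {X Y} g := by
    rintro _ ⟨h, rfl⟩
    exact ⟨h ≫ g.hom, ObjectProperty.hom_ext _ (Category.assoc _ _ _).symm⟩

/-- Every irreducible representation admits a functor morphing. -/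
theorem exists_functorMorphs [∀ i, Finite (M i)] [CharZero K]
    {V : Type w} [AddCommGroup V] [Module K V] (ρ : Representation K (AutGroup R M a) V)
    [ρ.IsIrreducible] :
    ∃ (F : FunCat R M k) (U : Type (max v w uK)) (_ : AddCommGroup U) (_ : Module K U)
      (σ : Representation K (Aut F) U), FunctorMorphs ρ F σ := by
  obtain ⟨F, hF, h⟩ := exists_isTypical (ρ := ρ) k
  exact ⟨F, IsTypical.exists_functorMorphs h⟩

variable [∀ i, Finite (M i)] [∀ i, IsIndecomposable R (M i)] [CharZero K]
  {hM : ∀ i j, i ≠ j → IsEmpty (M i ≃ₗ[R] M j)}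
  {V : Type w} [AddCommGroup V] [Module K V] {ρ : Representation K (AutGroup R M a) V}

/-- A degenerate representation occurs in `KG(M)` for a proper quotient `G` of `Hom_C(M, -)`. -/
theorem IsDegenerate.exists_occursIn [ρ.IsIrreducible] (hρ : IsDegenerate hM ρ) :
    ∃ G : FunCat R M k, IsProperSubquotient G (homFunctor R M k a) ∧ OccursIn ρ G := by
  obtain ⟨i, f, v, hf, hv, h⟩ := hρ.exists_fixed
  let S := SubFun.factorThrough k f
  have hS : ∀ g : Module.End R (DirSum M a), (endHom g : dirSumObj R M a ⟶ dirSumObj R M a) ∈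
      S.carrier (dirSumObj R M a) ↔ ∃ h : M i →ₗ[R] DirSum M a, g = h ∘ₗ f := by
    intro g
    constructor
    · rintro ⟨h, hh⟩
      exact ⟨h.hom, (congrArg (fun t : dirSumObj R M a ⟶ dirSumObj R M a => t.hom.hom) hh).symm⟩
    · rintro ⟨h, rfl⟩
      exact ⟨ModuleCat.ofHom h, rfl⟩
  have := finite_homFunctor (R := R) (M := M) (k := k) a
  refine ⟨S.quotient, S.isProperSubquotient_quotient (X := dirSumObj R M fun _ => 1) ?_, ?_⟩
  · intro hbot
    -- The morphism `f` itself, followed by the inclusion of `M_i`, shows that the subfunctor is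
    -- non-zero.
    let φ : (homFunctor R M k a).obj.obj (dirSumObj R M fun _ => 1) :=
      ObjectProperty.homMk (ModuleCat.ofHom (incl R M (fun _ => 1) i 0 ∘ₗ f))
    have h1 : φ ∈ S.carrier (dirSumObj R M fun _ => 1) :=
      ⟨ModuleCat.ofHom (incl R M (fun _ => 1) i 0), rfl⟩
    rw [hbot, Submodule.mem_bot] at h1
    have h2 : incl R M (fun _ => 1) i 0 ∘ₗ f = 0 :=
      congrArg (fun t : dirSumObj R M a ⟶ dirSumObj R M fun _ => 1 => t.hom.hom) h1
    refine hf ?_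
    rw [← LinearMap.id_comp f, ← proj_comp_incl_same R M (fun _ => 1) i 0, LinearMap.comp_assoc,
      h2, LinearMap.comp_zero]
  -- An automorphism `g` fixes the class of the identity only if `g - 1` factors through `f`, and
  -- such `g` fix `v`.
  · refine occursIn_of_fixed (S.π.hom.app (dirSumObj R M a) (𝟙 (dirSumObj R M a))) hv
      fun g hg => ?_
    have h1 : S.π.hom.app (dirSumObj R M a) (autHom R M g) =
        S.π.hom.app (dirSumObj R M a) (𝟙 (dirSumObj R M a)) := by
      refine Eq.trans ?_ hg
      exact congrArg (S.π.hom.app (dirSumObj R M a)) (Category.id_comp (autHom R M g)).symm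
    have h2 := (Submodule.Quotient.eq (S.carrier (dirSumObj R M a))).1 h1
    obtain ⟨h', hh'⟩ := (hS (toEnd R M a g - 1)).1 h2
    exact h g h' hh'

/-- A degenerate representation does not admit a trivial functor morphing. -/
theorem IsDegenerate.not_admitsTrivial [ρ.IsIrreducible] (hρ : IsDegenerate hM ρ) :
    ¬ AdmitsTrivialFunctorMorphing k ρ := by
  rintro ⟨F, U, _, _, σ, hσ, e, -⟩
  obtain ⟨G, hG, hGρ⟩ := hρ.exists_occursIn k
  exact hσ.1.2 G (hG.of_iso e) hGρ

end Degenerate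

end FunctorMorphing

end

theorem mainTheorem5
    -- a complete discrete valuation ring with finite residue field
    {𝔬 : Type*} [CommRing 𝔬] [IsDomain 𝔬] [IsDiscreteValuationRing 𝔬]
    [IsAdicComplete (IsLocalRing.maximalIdeal 𝔬) 𝔬] [Finite (IsLocalRing.ResidueField 𝔬)]
    (ℓ : ℕ)
    -- a finite algebra over `𝔬 / 𝔭 ^ ℓ`
    {R : Type*} [Ring R] [Finite R] [Algebra (𝔬 ⧸ IsLocalRing.maximalIdeal 𝔬 ^ ℓ) R]
    -- an algebraically closed field of characteristic zero
    {K : Type*} [Field K] [IsAlgClosed K] [CharZero K]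
    -- pairwise non-isomorphic finite indecomposable `R`-modules `M_1, …, M_n`, and multiplicities
    {n : ℕ} (M : Fin n → Type*) [∀ i, AddCommGroup (M i)] [∀ i, Module R (M i)]
    [∀ i, Finite (M i)] [∀ i, FunctorMorphing.IsIndecomposable R (M i)]
    (hM : ∀ i j, i ≠ j → IsEmpty (M i ≃ₗ[R] M j)) (a : Fin n → ℕ)
    -- an irreducible representation of `Aut_R(M)`, `M = M_1^{a_1} ⊕ ⋯ ⊕ M_n^{a_n}`
    {V : Type*} [AddCommGroup V] [Module K V]
    (ρ : Representation K (FunctorMorphing.AutGroup R M a) V) (hρ : ρ.IsIrreducible) :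
    (FunctorMorphing.IsDegenerate hM ρ →
      FunctorMorphing.AdmitsNontrivialFunctorMorphing
          (𝔬 ⧸ IsLocalRing.maximalIdeal 𝔬 ^ ℓ) ρ ∧
        ¬ FunctorMorphing.AdmitsTrivialFunctorMorphing
          (𝔬 ⧸ IsLocalRing.maximalIdeal 𝔬 ^ ℓ) ρ) ∧
    (FunctorMorphing.AdmitsTrivialFunctorMorphing
        (𝔬 ⧸ IsLocalRing.maximalIdeal 𝔬 ^ ℓ) ρ →
      ∀ i : Fin n, ∑ e : FunctorMorphing.LMArrow R M with e.target = i, a e.source ≤ a i) := by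
  have := hρ
  have hV := FunctorMorphing.isIrreducible_nontrivial ρ
  refine ⟨fun h => ⟨?_, h.not_admitsTrivial _⟩, fun h i => ?_⟩
  · obtain ⟨F, U, _, _, σ, hσ⟩ :=
      FunctorMorphing.exists_functorMorphs (𝔬 ⧸ IsLocalRing.maximalIdeal 𝔬 ^ ℓ) ρ
    -- Whatever morphing exists must be non-trivial, because degeneracy excludes all trivial ones.
    exact ⟨F, U, _, _, σ, hσ, fun ht => h.not_admitsTrivial _ ⟨F, U, _, _, σ, hσ, ht⟩⟩
  · rw [FunctorMorphing.sum_source_eq_lmTotalDim]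
    by_contra! hlt
    exact (FunctorMorphing.isDegenerate_of_lt ρ hM hlt).not_admitsTrivial _ h
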